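/- Let $\mathbf{k}$ be an algebraically closed, complete normed field of characteristic zero, and let $\mathcal{O}$ be either the ring $\mathbf{k}\{x,y\}$ of locally converging power series or the ring $\mathbf{k}[[x,y]]$ of formal power series. For $0\neq f\in\mathcal{O}$ with lowest order homogeneous form $f_m$, let $\mathrm{mult}(\{f=0\},0)=m$ be the order of $f$, and let the tangent cone of the plane curve germ $\{f=0\}$ be the set $\{f_m=0\}\subset\mathbf{k}^2$; the curve is considered with its multiplicities, i.e. $f$ is taken up to units of $\mathcal{O}$. The tangential decomposition $(C,0)=\bigcup_\alpha (C_\alpha,0)$ of $(C,0)=\{f=0\}$ is given by a factorization $f=u\prod_\alpha f_\alpha$ with $u\in\mathcal{O}^*$, where $\alpha$ runs over the (finitely many, pairwise distinct) lines of the tangent cone of $C$, and where the tangent cone of $(C_\alpha,0)=\{f_\alpha=0\}$ is, as a set, the line $\alpha$. (The $C_\alpha$ may be reducible or non-reduced.) A determinantal representation of $\{f=0\}$ is a square matrix $\mathcal{M}$ over $\mathcal{O}$ with $\mathcal{M}(0)=0$ and $0\neq\det\mathcal{M}=u f$ for some $u\in\mathcal{O}^*$. It is maximally generated at the origin if $\mathrm{corank}\,\mathcal{M}(0)=\mathrm{mult}(\{\det\mathcal{M}=0\},0)$.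 Two $p\times p$ matrices are locally equivalent, $\mathcal{M}\sim\mathcal{N}$, if $\mathcal{M}=A\mathcal{N}B$ for some $A,B\in GL(p,\mathcal{O})$. Theorem. Let $\mathcal{M}$ be a $p\times p$ determinantal representation of the plane curve germ $(C,0)$ that is maximally generated at the origin. Then the tangential decomposition $(C,0)=\bigcup_\alpha(C_\alpha,0)$ exists, and for any such decomposition, with $p_\alpha=\mathrm{mult}(C_\alpha,0)$, the matrix $\mathcal{M}$ is locally equivalent to a block-diagonal matrix $\bigoplus_\alpha\mathcal{M}_\alpha$, where $\mathcal{M}_\alpha$ is a $p_\alpha\times p_\alpha$ determinantal representation of $(C_\alpha,0)$, maximally generated at the origin. -/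

import Mathlib

namespace PlaneCurveGerm

open MvPowerSeries

noncomputable section

/-- A formal power series in two variables converges near the origin if it converges absolutely
on some polydisc of positive radius. -/
def IsConvergent {k : Type*} [NormedField k] (f : MvPowerSeries (Fin 2) k) : Prop :=
  ∃ r : ℝ, 0 < r ∧ Summable fun d : Fin 2 →₀ ℕ => ‖coeff d f‖ * r ^ d.degree

theorem IsConvergent.mono_radius {k : Type*} [NormedField k] {f : MvPowerSeries (Fin 2) k}
    {r s : ℝ} (hs : 0 < s) (hsr : s ≤ r)
    (h : Summable fun d : Fin 2 →₀ ℕ => ‖coeff d f‖ * r ^ d.degree) :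
    Summable fun d : Fin 2 →₀ ℕ => ‖coeff d f‖ * s ^ d.degree := by
  refine Summable.of_nonneg_of_le (fun d => by positivity) (fun d => ?_) h
  gcongr

theorem IsConvergent.add {k : Type*} [NormedField k] {f g : MvPowerSeries (Fin 2) k}
    (hf : IsConvergent f) (hg : IsConvergent g) : IsConvergent (f + g) := by
  obtain ⟨r, hr, hf⟩ := hf
  obtain ⟨s, hs, hg⟩ := hg
  have ht : 0 < min r s := lt_min hr hs
  refine ⟨min r s, ht, ?_⟩
  refine Summable.of_nonneg_of_le (fun d => by positivity) (fun d => ?_)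
    ((IsConvergent.mono_radius ht (min_le_left r s) hf).add
      (IsConvergent.mono_radius ht (min_le_right r s) hg))
  rw [← add_mul, map_add]
  gcongr
  exact norm_add_le _ _

theorem IsConvergent.mul {k : Type*} [NormedField k] {f g : MvPowerSeries (Fin 2) k}
    (hf : IsConvergent f) (hg : IsConvergent g) : IsConvergent (f * g) := by
  obtain ⟨r, hr, hf⟩ := hf
  obtain ⟨s, hs, hg⟩ := hg
  have ht : 0 < min r s := lt_min hr hs
  refine ⟨min r s, ht, ?_⟩
  have hf' := IsConvergent.mono_radius ht (min_le_left r s) hf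
  have hg' := IsConvergent.mono_radius ht (min_le_right r s) hg
  set F : (Fin 2 →₀ ℕ) → ℝ := fun d => ‖coeff d f‖ * min r s ^ d.degree with hF
  set G : (Fin 2 →₀ ℕ) → ℝ := fun d => ‖coeff d g‖ * min r s ^ d.degree with hG
  have hF0 : 0 ≤ F := fun d => mul_nonneg (norm_nonneg _) (pow_nonneg ht.le _)
  have hG0 : 0 ≤ G := fun d => mul_nonneg (norm_nonneg _) (pow_nonneg ht.le _)
  have hFG : Summable fun x : (Fin 2 →₀ ℕ) × (Fin 2 →₀ ℕ) => F x.1 * G x.2 :=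
    Summable.mul_of_nonneg hf' hg' hF0 hG0
  have hp : Summable fun d => ∑ x ∈ Finset.HasAntidiagonal.antidiagonal d, F x.1 * G x.2 :=
    summable_sum_mul_antidiagonal_of_summable_mul hFG
  refine Summable.of_nonneg_of_le (fun d => mul_nonneg (norm_nonneg _) (pow_nonneg ht.le _))
    (fun d => ?_) hp
  have h1 : ‖coeff d (f * g)‖ ≤ ∑ x ∈ Finset.HasAntidiagonal.antidiagonal d,
      ‖coeff x.1 f‖ * ‖coeff x.2 g‖ := by
    rw [coeff_mul]
    refine (norm_sum_le _ _).trans (Finset.sum_le_sum fun x _ => ?_)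
    exact norm_mul_le _ _
  refine (mul_le_mul_of_nonneg_right h1 (pow_nonneg ht.le _)).trans_eq ?_
  rw [Finset.sum_mul]
  refine Finset.sum_congr rfl fun x hx => ?_
  have h2 : d.degree = x.1.degree + x.2.degree := by
    rw [← Finset.HasAntidiagonal.mem_antidiagonal.mp hx, map_add]
  rw [h2, pow_add, hF, hG]
  ring

theorem isConvergent_C {k : Type*} [NormedField k] (a : k) :
    IsConvergent (C a : MvPowerSeries (Fin 2) k) := by
  classical
  refine ⟨1, one_pos, summable_of_ne_finset_zero (s := {0}) fun d hd => ?_⟩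
  rw [coeff_C, if_neg (by simpa using hd)]
  simp

/-- The ring `k{x,y}` of locally converging power series, inside `k[[x,y]]`. -/
def convergentSeries (k : Type*) [NormedField k] : Subalgebra k (MvPowerSeries (Fin 2) k) where
  carrier := {f | IsConvergent f}
  mul_mem' := IsConvergent.mul
  add_mem' := IsConvergent.add
  algebraMap_mem' := isConvergent_C

section Curves

variable {k : Type*} [Field k]

/-- The multiplicity at the origin of the curve germ `{f = 0}`: the order of vanishing of `f`. -/
def mult (f : MvPowerSeries (Fin 2) k) : ℕ := f.order.toNat

/-- The lowest order homogeneous form `f_p` in the Taylor expansion `f = f_p + f_{p+1} + ⋯`. -/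
def initialForm (f : MvPowerSeries (Fin 2) k) : MvPolynomial (Fin 2) k :=
  ∑ d ∈ Finset.univ.finsuppAntidiag (mult f), MvPolynomial.monomial d (coeff d f)

/-- The tangent cone `{f_p = 0} ⊆ k²` of the germ `{f = 0}`, as a set. -/
def tangentCone (f : MvPowerSeries (Fin 2) k) : Set (Fin 2 → k) :=
  {v | MvPolynomial.eval v (initialForm f) = 0}

/-- The tangent lines of `{f = 0}`, i.e. the set-theoretic components of its tangent cone. -/
def tangentLines (f : MvPowerSeries (Fin 2) k) : Set (Submodule k (Fin 2 → k)) :=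
  {L | Module.finrank k L = 1 ∧ (L : Set (Fin 2 → k)) ⊆ tangentCone f}

/-- A tangential decomposition of the curve germ `{f = 0}` over the local ring `O`: one component
`{comp i = 0}` for each tangent line of `{f = 0}`, the tangent cone of the component being
set-theoretically this line, whose union (with multiplicities) is `{f = 0}`. -/
structure TangentialDecomposition {O : Subalgebra k (MvPowerSeries (Fin 2) k)} (f : O) where
  /-- the number of tangent lines -/
  r : ℕ
  /-- the enumeration of all tangent lines, without repetition -/
  line : Fin r ≃ tangentLines (f : MvPowerSeries (Fin 2) k)
  /-- the defining equations of the components -/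
  comp : Fin r → O
  associated_prod : Associated f (∏ i, comp i)
  tangentCone_comp : ∀ i, tangentCone (comp i : MvPowerSeries (Fin 2) k) =
    ((line i : Submodule k (Fin 2 → k)) : Set (Fin 2 → k))

variable {O : Subalgebra k (MvPowerSeries (Fin 2) k)} {m n : Type*} [Fintype m] [DecidableEq m]
  [Fintype n] [DecidableEq n]

/-- The value `M(0)` at the origin of a matrix of functions. -/
def valueAtZero (M : Matrix n n O) : Matrix n n k :=
  M.map fun g => constantCoeff (g : MvPowerSeries (Fin 2) k)

/-- The corank of the constant matrix `M(0)`. -/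
def corankAtZero (M : Matrix n n O) : ℕ := Fintype.card n - (valueAtZero M).rank

/-- `M` is a (local) determinantal representation of the curve germ `{f = 0}`: `M` vanishes at the
origin, and `det M` is not identically zero and defines the same germ (with multiplicities). -/
structure IsDetRep (M : Matrix n n O) (f : O) : Prop where
  vanishes : valueAtZero M = 0
  det_ne_zero : M.det ≠ 0
  associated : Associated M.det f

/-- `M` is maximally generated at the origin: `corank M(0) = mult({det M = 0}, 0)`. -/
def IsMaximallyGenerated (M : Matrix n n O) : Prop :=
  corankAtZero M = mult (M.det : MvPowerSeries (Fin 2) k)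

/-- Local equivalence `M = A N B` with `A`, `B` invertible over the local ring `O`; the bijection
`e` only matches the labels of the rows and columns. -/
def LocallyEquivalent (M : Matrix m m O) (N : Matrix n n O) : Prop :=
  ∃ (e : m ≃ n) (A B : Matrix.GeneralLinearGroup n O),
    Matrix.reindex e e M = (A : Matrix n n O) * N * (B : Matrix n n O)

end Curves

end

end PlaneCurveGerm

namespace PlaneCurveGerm

open MvPowerSeries

noncomputable section

/-! ### The order filtration -/

section OrderIdeal

variable {k : Type*} [Field k]

/-! Since M vanishes at the origin, maximal generation says that det M has order equal to the size p
of M. Write M = xP + yQ. The degree-p form det(xP(0) + yQ(0)) is the degree-p part of det M, hence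
nonzero, so some aP(0) + bQ(0) is invertible. In suitable linear coordinates u, v this gives M =
G(u·1 + vT) with G invertible (`IsAdmissible.exists_normalForm`).

Conjugating T now acts on M by equivalence. The value T(0) can be put in Jordan form over k, and the
splitting of k^p into generalized eigenspaces lifts to the local ring: the off-diagonal part of the
conjugating matrix solves a Riccati equation, whose linear part is a Sylvester operator, invertible
between different eigenvalues (`exists_sylvester_inverse`, `IsAdmissible.exists_block_conj`). A
block u·1 + vΛ with the single eigenvalue μ at the origin has determinant with lowest form (u +
μv)^m, m its size. So the blocks correspond to the tangent lines, are maximally generated, and their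
determinants form a tangential decomposition.

Any other tangential decomposition has the same components up to units
(`IsAdmissible.associated_of_associated_prod`). Its initial forms are powers of the same linear
forms by unique factorization of polynomials. Two components with different tangents generate an
ideal containing a power of the maximal ideal, by Nakayama, and therefore form a regular sequence;
thus a component divides its counterpart as soon as it divides the full product, and conversely.

Everything used about the local ring is collected in `IsAdmissible`: division by coordinates and
solvability of polynomial systems w = p(w) whose coefficients vanish at the origin. Formally such a
system is solved by iteration; for convergent coefficients a weighted norm estimate shows that the
formal solution converges. -/

/-- The ideal of power series of order at least `n`. -/
def orderIdeal (k : Type*) [Field k] (n : ℕ) : Ideal (MvPowerSeries (Fin 2) k) where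
  carrier := {f | (n : ℕ∞) ≤ f.order}
  zero_mem' := by simp
  add_mem' := fun ha hb => (le_min ha hb).trans min_order_le_add
  smul_mem' := fun c f hf => by
    have : f.order ≤ (c * f).order := le_add_self.trans le_order_mul
    exact le_trans hf this

theorem mem_orderIdeal {n : ℕ} {f : MvPowerSeries (Fin 2) k} :
    f ∈ orderIdeal k n ↔ (n : ℕ∞) ≤ f.order := Iff.rfl

theorem mem_orderIdeal_iff_coeff {n : ℕ} {f : MvPowerSeries (Fin 2) k} :
    f ∈ orderIdeal k n ↔ ∀ d : Fin 2 →₀ ℕ, d.degree < n → coeff d f = 0 :=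
  ⟨fun h d hd => coeff_of_lt_order (lt_of_lt_of_le (by exact_mod_cast hd) h),
    fun h => nat_le_order h⟩

theorem mem_orderIdeal_one {f : MvPowerSeries (Fin 2) k} :
    f ∈ orderIdeal k 1 ↔ constantCoeff f = 0 := by
  rw [mem_orderIdeal, Nat.cast_one, one_le_order_iff_constCoeff_eq_zero]

theorem mul_mem_orderIdeal {m n : ℕ} {f g : MvPowerSeries (Fin 2) k}
    (hf : f ∈ orderIdeal k m) (hg : g ∈ orderIdeal k n) : f * g ∈ orderIdeal k (m + n) := by
  rw [mem_orderIdeal] at *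
  push_cast
  exact (add_le_add hf hg).trans le_order_mul

theorem orderIdeal_antitone {m n : ℕ} (h : m ≤ n) : orderIdeal k n ≤ orderIdeal k m :=
  fun _ hf => le_trans (by exact_mod_cast h) (mem_orderIdeal.1 hf)

/-- Monomials respect congruence modulo order n, and each coefficient contributes one extra order:
this is the contraction property in the order filtration. -/
theorem eval_sub_eval_mem_orderIdeal {J : Type*} (p : MvPolynomial J (MvPowerSeries (Fin 2) k))
    (hp : ∀ e, constantCoeff (MvPolynomial.coeff e p) = 0) {n : ℕ}
    {w w' : J → MvPowerSeries (Fin 2) k} (h : ∀ j, w j - w' j ∈ orderIdeal k n) :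
    MvPolynomial.eval w p - MvPolynomial.eval w' p ∈ orderIdeal k (n + 1) := by
  rw [MvPolynomial.eval_eq, MvPolynomial.eval_eq, ← Finset.sum_sub_distrib]
  refine Ideal.sum_mem _ fun e _ => ?_
  rw [← mul_sub, add_comm n 1]
  refine mul_mem_orderIdeal (mem_orderIdeal_one.2 (hp e)) ?_
  rw [← Ideal.Quotient.mk_eq_mk_iff_sub_mem, map_prod, map_prod]
  refine Finset.prod_congr rfl fun j _ => ?_
  rw [map_pow, map_pow, Ideal.Quotient.mk_eq_mk_iff_sub_mem _ _ |>.2 (h j)]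

/-- A polynomial system `w = p(w)` whose coefficients have no constant term can be solved in
formal power series. -/
theorem exists_eq_eval {J : Type*} (p : J → MvPolynomial J (MvPowerSeries (Fin 2) k))
    (hp : ∀ j e, constantCoeff (MvPolynomial.coeff e (p j)) = 0) :
    ∃ w : J → MvPowerSeries (Fin 2) k, ∀ j, w j = MvPolynomial.eval w (p j) := by
  let Φ : (J → MvPowerSeries (Fin 2) k) → J → MvPowerSeries (Fin 2) k :=
    fun w j => MvPolynomial.eval w (p j)
  let W : ℕ → J → MvPowerSeries (Fin 2) k := fun n => Φ^[n] 0
  have hW : ∀ n, W (n + 1) = Φ (W n) := fun n => Function.iterate_succ_apply' Φ n 0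
  have step : ∀ n j, W (n + 1) j - W n j ∈ orderIdeal k n := by
    intro n
    induction n with
    | zero => intro j; simp [mem_orderIdeal]
    | succ n ih =>
      intro j
      rw [hW (n + 1)]
      nth_rw 2 [hW n]
      exact eval_sub_eval_mem_orderIdeal (p j) (hp j) ih
  have stab : ∀ m n, n ≤ m → ∀ j, W m j - W n j ∈ orderIdeal k n := by
    intro m n hmn
    induction m, hmn using Nat.le_induction with
    | base => intro j; simp
    | succ m hmn ih =>
      intro j
      have := Ideal.add_mem _ (orderIdeal_antitone hmn (step m j)) (ih j)
      simpa using this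
  -- All iterates from the n-th on agree in degrees below n, so the coefficient at d is final at
  -- iterate `d.degree + 1`.
  let w : J → MvPowerSeries (Fin 2) k := fun j d => coeff d (W (d.degree + 1) j)
  have hw : ∀ n j, w j - W n j ∈ orderIdeal k n := by
    intro n j
    rw [mem_orderIdeal_iff_coeff]
    intro d hd
    have h1 := mem_orderIdeal_iff_coeff.1 (stab n (d.degree + 1) hd j) d (Nat.lt_succ_self _)
    rw [map_sub, sub_eq_zero] at h1
    rw [map_sub, sub_eq_zero, h1]
    rfl
  refine ⟨w, fun j => ?_⟩
  ext d
  have h1 := mem_orderIdeal_iff_coeff.1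
    (eval_sub_eval_mem_orderIdeal (p j) (hp j) (hw d.degree)) d (Nat.lt_succ_self _)
  have h2 := mem_orderIdeal_iff_coeff.1 (hw (d.degree + 1) j) d (Nat.lt_succ_self _)
  rw [map_sub, sub_eq_zero] at h1 h2
  rw [h1, h2, hW]

end OrderIdeal

/-! ### Shifts -/

section Shift

variable {k : Type*} [Field k]

/-- The quotient by `x` of the part of a series that is divisible by `x`. -/
def shiftX (f : MvPowerSeries (Fin 2) k) : MvPowerSeries (Fin 2) k :=
  fun d => coeff (d + Finsupp.single 0 1) f

/-- The quotient by `y` of the nonconstant part of the restriction of a series to `x = 0`. -/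
def shiftY (f : MvPowerSeries (Fin 2) k) : MvPowerSeries (Fin 2) k :=
  fun d => if d 0 = 0 then coeff (d + Finsupp.single 1 1) f else 0

theorem coeff_shiftX (f : MvPowerSeries (Fin 2) k) (d : Fin 2 →₀ ℕ) :
    coeff d (shiftX f) = coeff (d + Finsupp.single 0 1) f := rfl

theorem coeff_shiftY (f : MvPowerSeries (Fin 2) k) (d : Fin 2 →₀ ℕ) :
    coeff d (shiftY f) = if d 0 = 0 then coeff (d + Finsupp.single 1 1) f else 0 := rfl

theorem eq_X_mul_shiftX_add {f : MvPowerSeries (Fin 2) k} (hf : constantCoeff f = 0) :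
    f = X 0 * shiftX f + X 1 * shiftY f := by
  ext d
  have h : (d - Finsupp.single 1 1 : Fin 2 →₀ ℕ) 0 = d 0 := by simp
  rw [map_add, mul_comm, mul_comm (X 1), X_def, X_def, coeff_mul_monomial, coeff_mul_monomial]
  simp only [mul_one, coeff_shiftX, coeff_shiftY, Finsupp.single_le_iff, h]
  by_cases h0 : 1 ≤ d 0
  · rw [if_pos h0, tsub_add_cancel_of_le (Finsupp.single_le_iff.2 h0),
      if_neg (by omega : ¬ d 0 = 0)]
    simp
  · rw [if_neg h0, if_pos (by omega : d 0 = 0), zero_add]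
    by_cases h1 : 1 ≤ d 1
    · rw [if_pos h1, tsub_add_cancel_of_le (Finsupp.single_le_iff.2 h1)]
    · rw [if_neg h1]
      have : d = 0 := by
        ext i; fin_cases i <;> simp <;> omega
      subst this
      simpa using hf

theorem X_mul_shiftX {f : MvPowerSeries (Fin 2) k} (hf : X 0 ∣ f) : X 0 * shiftX f = f := by
  rw [X_dvd_iff] at hf
  ext d
  rw [mul_comm, X_def, coeff_mul_monomial]
  simp only [mul_one, coeff_shiftX, Finsupp.single_le_iff]
  by_cases h0 : 1 ≤ d 0
  · rw [if_pos h0, tsub_add_cancel_of_le (Finsupp.single_le_iff.2 h0)]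
  · rw [if_neg h0, hf d (by omega)]

theorem shiftX_mem_orderIdeal {n : ℕ} {f : MvPowerSeries (Fin 2) k}
    (hf : f ∈ orderIdeal k (n + 1)) : shiftX f ∈ orderIdeal k n := by
  rw [mem_orderIdeal_iff_coeff] at *
  intro d hd
  exact hf _ (by simpa using hd)

theorem shiftY_mem_orderIdeal {n : ℕ} {f : MvPowerSeries (Fin 2) k}
    (hf : f ∈ orderIdeal k (n + 1)) : shiftY f ∈ orderIdeal k n := by
  rw [mem_orderIdeal_iff_coeff] at *
  intro d hd
  rw [coeff_shiftY, hf _ (by simpa using hd), ite_self]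

end Shift

/-! ### Rings of power series with an implicit function theorem -/

/-- A subalgebra of the ring of formal power series that contains the coordinates, and is closed
under the quotients by coordinates and under solutions of contracting polynomial systems. -/
structure IsAdmissible {k : Type*} [Field k] (O : Subalgebra k (MvPowerSeries (Fin 2) k)) :
    Prop where
  X_mem : ∀ i, X i ∈ O
  shiftX_mem : ∀ f ∈ O, shiftX f ∈ O
  shiftY_mem : ∀ f ∈ O, shiftY f ∈ O
  exists_eq_eval : ∀ (J : Type) [Finite J] (p : J → MvPolynomial J O),
    (∀ j e, constantCoeff ((MvPolynomial.coeff e (p j) : O) : MvPowerSeries (Fin 2) k) = 0) →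
      ∃ w : J → O, ∀ j, w j = MvPolynomial.eval w (p j)

theorem coe_eval {k : Type*} [Field k] (O : Subalgebra k (MvPowerSeries (Fin 2) k)) {J : Type*}
    (w : J → O) (p : MvPolynomial J O) :
    ((MvPolynomial.eval w p : O) : MvPowerSeries (Fin 2) k) =
      MvPolynomial.eval (fun j => (w j : MvPowerSeries (Fin 2) k))
        (MvPolynomial.map O.val.toRingHom p) := by
  rw [MvPolynomial.eval_map]
  exact MvPolynomial.eval₂_comp_left O.val.toRingHom (RingHom.id O) w p

theorem isAdmissible_top {k : Type*} [Field k] :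
    IsAdmissible (⊤ : Subalgebra k (MvPowerSeries (Fin 2) k)) where
  X_mem _ := trivial
  shiftX_mem _ _ := trivial
  shiftY_mem _ _ := trivial
  exists_eq_eval J _ p hp := by
    obtain ⟨w, hw⟩ := PlaneCurveGerm.exists_eq_eval
      (fun j => MvPolynomial.map (⊤ : Subalgebra k _).val.toRingHom (p j))
      (fun j e => by rw [MvPolynomial.coeff_map]; exact hp j e)
    refine ⟨fun j => ⟨w j, trivial⟩, fun j => Subtype.ext ?_⟩
    rw [coe_eval]
    exact hw j

/-! ### Weighted norms and convergent power series -/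

section WeightedNorm

open scoped ENNReal NNReal Topology
open Filter

variable {k : Type*} [NormedField k]

/-- The weighted `ℓ¹`-norm of a power series. -/
def weightedNorm (r : ℝ≥0) (f : MvPowerSeries (Fin 2) k) : ℝ≥0∞ :=
  ∑' d : Fin 2 →₀ ℕ, ‖coeff d f‖ₑ * (r : ℝ≥0∞) ^ d.degree

/-- The weighted `ℓ¹`-norm of the part of degree less than `n` of a power series. -/
def truncNorm (r : ℝ≥0) (n : ℕ) (f : MvPowerSeries (Fin 2) k) : ℝ≥0∞ :=
  ∑' d : Fin 2 →₀ ℕ, if d.degree < n then ‖coeff d f‖ₑ * (r : ℝ≥0∞) ^ d.degree else 0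

theorem isConvergent_iff {f : MvPowerSeries (Fin 2) k} :
    IsConvergent f ↔ ∃ r : ℝ≥0, 0 < r ∧ weightedNorm r f ≠ ∞ := by
  have key : ∀ r : ℝ≥0, weightedNorm r f ≠ ∞ ↔
      Summable fun d : Fin 2 →₀ ℕ => ‖coeff d f‖ * (r : ℝ) ^ d.degree := by
    intro r
    have h1 : weightedNorm r f =
        ∑' d : Fin 2 →₀ ℕ, ((‖coeff d f‖₊ * r ^ d.degree : ℝ≥0) : ℝ≥0∞) := by
      simp [weightedNorm, enorm_eq_nnnorm]
    rw [h1, ENNReal.tsum_coe_ne_top_iff_summable, ← NNReal.summable_coe]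
    simp
  constructor
  · rintro ⟨r, hr, h⟩
    exact ⟨⟨r, hr.le⟩, hr, (key _).2 h⟩
  · rintro ⟨r, hr, h⟩
    exact ⟨r, hr, (key _).1 h⟩

theorem truncNorm_le_weightedNorm (r : ℝ≥0) (n : ℕ) (f : MvPowerSeries (Fin 2) k) :
    truncNorm r n f ≤ weightedNorm r f :=
  ENNReal.tsum_le_tsum fun d => by split_ifs <;> simp

/-- Every finite partial sum lies below some degree, so bounds on truncations uniform in n pass to
the whole series. -/
theorem weightedNorm_le {r : ℝ≥0} {f : MvPowerSeries (Fin 2) k} {c : ℝ≥0∞}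
    (h : ∀ n, truncNorm r n f ≤ c) : weightedNorm r f ≤ c := by
  rw [weightedNorm, ENNReal.tsum_eq_iSup_sum]
  refine iSup_le fun s => ?_
  refine le_trans ?_ (h (s.sup Finsupp.degree + 1))
  refine le_trans (Finset.sum_le_sum fun d hd => ?_) (ENNReal.sum_le_tsum s)
  rw [if_pos (Nat.lt_succ_of_le (Finset.le_sup (f := Finsupp.degree) hd))]

theorem tsum_le_mul_of_le_antidiagonal {F G H : (Fin 2 →₀ ℕ) → ℝ≥0∞}
    (h : ∀ d, H d ≤ ∑ x ∈ Finset.HasAntidiagonal.antidiagonal d, F x.1 * G x.2) :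
    ∑' d, H d ≤ (∑' d, F d) * ∑' d, G d := by
  calc ∑' d, H d ≤ ∑' d, ∑ x ∈ Finset.HasAntidiagonal.antidiagonal d, F x.1 * G x.2 :=
        ENNReal.tsum_le_tsum h
    _ = ∑' x : (Fin 2 →₀ ℕ) × (Fin 2 →₀ ℕ), F x.1 * G x.2 := by
        rw [← Equiv.tsum_eq Finset.HasAntidiagonal.sigmaAntidiagonalEquivProd, ENNReal.tsum_sigma']
        refine tsum_congr fun d => ?_
        rw [tsum_fintype, ← Finset.sum_coe_sort]
        rfl
    _ = (∑' d, F d) * ∑' d, G d := by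
        rw [ENNReal.tsum_prod (f := fun a b => F a * G b)]
        simp_rw [ENNReal.tsum_mul_left, ENNReal.tsum_mul_right]

theorem enorm_coeff_mul_le (r : ℝ≥0) (f g : MvPowerSeries (Fin 2) k) (d : Fin 2 →₀ ℕ) :
    ‖coeff d (f * g)‖ₑ * (r : ℝ≥0∞) ^ d.degree ≤
      ∑ x ∈ Finset.HasAntidiagonal.antidiagonal d,
        (‖coeff x.1 f‖ₑ * (r : ℝ≥0∞) ^ x.1.degree) *
          (‖coeff x.2 g‖ₑ * (r : ℝ≥0∞) ^ x.2.degree) := by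
  rw [coeff_mul]
  refine (mul_le_mul_left (enorm_sum_le _ _) _).trans_eq ?_
  rw [Finset.sum_mul]
  refine Finset.sum_congr rfl fun x hx => ?_
  rw [← Finset.HasAntidiagonal.mem_antidiagonal.mp hx, map_add, pow_add, enorm_mul]
  ring

theorem truncNorm_mul_le (r : ℝ≥0) (n : ℕ) (f g : MvPowerSeries (Fin 2) k) :
    truncNorm r n (f * g) ≤ truncNorm r n f * truncNorm r n g := by
  refine tsum_le_mul_of_le_antidiagonal fun d => ?_
  split_ifs with hd
  · refine (enorm_coeff_mul_le r f g d).trans_eq (Finset.sum_congr rfl fun x hx => ?_)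
    have := congrArg Finsupp.degree (Finset.HasAntidiagonal.mem_antidiagonal.mp hx)
    rw [map_add] at this
    rw [if_pos (by omega), if_pos (by omega)]
  · exact zero_le

/-- With no constant term in f, the coefficients of f * g in degree at most n involve g only in
degrees below n. This gain of one degree drives the induction in `isConvergent_of_eq_eval`. -/
theorem truncNorm_succ_mul_le (r : ℝ≥0) (n : ℕ) {f : MvPowerSeries (Fin 2) k}
    (hf : constantCoeff f = 0) (g : MvPowerSeries (Fin 2) k) :
    truncNorm r (n + 1) (f * g) ≤ weightedNorm r f * truncNorm r n g := by
  refine tsum_le_mul_of_le_antidiagonal fun d => ?_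
  split_ifs with hd
  · refine (enorm_coeff_mul_le r f g d).trans (Finset.sum_le_sum fun x hx => ?_)
    have := congrArg Finsupp.degree (Finset.HasAntidiagonal.mem_antidiagonal.mp hx)
    rw [map_add] at this
    by_cases h0 : x.1.degree = 0
    · rw [Finsupp.degree_eq_zero_iff] at h0
      rw [h0, coeff_zero_eq_constantCoeff_apply, hf]
      simp
    · rw [if_pos (by omega)]
  · exact zero_le

theorem truncNorm_sum_le (r : ℝ≥0) (n : ℕ) {ι : Type*} (s : Finset ι)
    (f : ι → MvPowerSeries (Fin 2) k) :
    truncNorm r n (∑ i ∈ s, f i) ≤ ∑ i ∈ s, truncNorm r n (f i) := by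
  simp only [truncNorm]
  rw [← Summable.tsum_finsetSum fun _ _ => ENNReal.summable]
  refine ENNReal.tsum_le_tsum fun d => ?_
  split_ifs
  · rw [map_sum, ← Finset.sum_mul]
    exact mul_le_mul_left (enorm_sum_le _ _) _
  · exact zero_le

theorem truncNorm_one_le (r : ℝ≥0) (n : ℕ) :
    truncNorm r n (1 : MvPowerSeries (Fin 2) k) ≤ 1 := by
  classical
  refine (truncNorm_le_weightedNorm r n 1).trans ?_
  rw [weightedNorm, tsum_eq_single 0]
  · simp
  · intro d hd
    rw [coeff_one, if_neg hd]
    simp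

theorem truncNorm_pow_le_one {r : ℝ≥0} {n : ℕ} {f : MvPowerSeries (Fin 2) k}
    (hf : truncNorm r n f ≤ 1) (m : ℕ) : truncNorm r n (f ^ m) ≤ 1 := by
  induction m with
  | zero => simpa using truncNorm_one_le r n
  | succ m ih =>
    rw [pow_succ]
    exact (truncNorm_mul_le r n _ _).trans (mul_le_one' ih hf)

theorem truncNorm_prod_le_one {r : ℝ≥0} {n : ℕ} {ι : Type*} (s : Finset ι)
    {f : ι → MvPowerSeries (Fin 2) k} (hf : ∀ i ∈ s, truncNorm r n (f i) ≤ 1) :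
    truncNorm r n (∏ i ∈ s, f i) ≤ 1 := by
  classical
  induction s using Finset.induction_on with
  | empty => simpa using truncNorm_one_le r n
  | insert i s hi ih =>
    rw [Finset.prod_insert hi]
    exact (truncNorm_mul_le r n _ _).trans (mul_le_one' (hf i (by simp))
      (ih fun j hj => hf j (by simp [hj])))

/-- Every surviving term has positive degree, so shrinking the radius from s to r scales the norm by
at most r / s. -/
theorem tendsto_weightedNorm {f : MvPowerSeries (Fin 2) k} (hf : IsConvergent f)
    (hf0 : constantCoeff f = 0) :
    Tendsto (fun r : ℝ≥0 => weightedNorm r f) (𝓝[>] 0) (𝓝 0) := by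
  obtain ⟨s, hs, hfs⟩ := isConvergent_iff.1 hf
  have hb : ∀ᶠ r : ℝ≥0 in 𝓝[>] 0, weightedNorm r f ≤ ((r / s : ℝ≥0) : ℝ≥0∞) * weightedNorm s f := by
    filter_upwards [nhdsWithin_le_nhds (Iio_mem_nhds hs)] with r hr
    rw [weightedNorm, weightedNorm, ← ENNReal.tsum_mul_left]
    refine ENNReal.tsum_le_tsum fun d => ?_
    rcases Nat.eq_zero_or_pos d.degree with h0 | h0
    · rw [Finsupp.degree_eq_zero_iff] at h0
      rw [h0, coeff_zero_eq_constantCoeff_apply, hf0]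
      simp
    · have h1 : r ^ d.degree ≤ r / s * s ^ d.degree := by
        have h2 : r ^ d.degree = (r / s) ^ d.degree * s ^ d.degree := by
          rw [← mul_pow, div_mul_cancel₀ _ hs.ne']
        rw [h2]
        gcongr
        exact pow_le_of_le_one zero_le (div_le_one_of_le₀ (le_of_lt hr) zero_le) h0.ne'
      have h3 : (r : ℝ≥0∞) ^ d.degree ≤ ((r / s : ℝ≥0) : ℝ≥0∞) * (s : ℝ≥0∞) ^ d.degree := by
        exact_mod_cast h1
      calc _ ≤ ‖coeff d f‖ₑ * (((r / s : ℝ≥0) : ℝ≥0∞) * (s : ℝ≥0∞) ^ d.degree) := by gcongr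
        _ = _ := by ring
  refine tendsto_of_tendsto_of_tendsto_of_le_of_le' tendsto_const_nhds ?_
    (Eventually.of_forall fun _ => zero_le) hb
  have h1 : Tendsto (fun r : ℝ≥0 => ((r / s : ℝ≥0) : ℝ≥0∞)) (𝓝[>] 0) (𝓝 0) := by
    have : Tendsto (fun r : ℝ≥0 => r / s) (𝓝 0) (𝓝 (0 / s)) := tendsto_id.div_const s
    rw [zero_div] at this
    exact ENNReal.tendsto_coe.2 (this.mono_left nhdsWithin_le_nhds)
  simpa using ENNReal.Tendsto.mul_const h1 (Or.inr hfs)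

/-- Choose r so small that the weighted norms of the coefficients of each p j add up to at most 1.
If the truncations of w below degree n have norm at most 1, so do all monomials in w, and the
equation carries the bound to degree n + 1. Hence every formal solution has norm at most 1 at radius
r. -/
theorem isConvergent_of_eq_eval {J : Type*} [Finite J]
    (p : J → MvPolynomial J (MvPowerSeries (Fin 2) k))
    (hp : ∀ j e, constantCoeff (MvPolynomial.coeff e (p j)) = 0)
    (hc : ∀ j e, IsConvergent (MvPolynomial.coeff e (p j)))
    {w : J → MvPowerSeries (Fin 2) k} (hw : ∀ j, w j = MvPolynomial.eval w (p j)) (j : J) :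
    IsConvergent (w j) := by
  have := Fintype.ofFinite J
  have h1 : ∀ j, Tendsto (fun r : ℝ≥0 => ∑ e ∈ (p j).support,
      weightedNorm r (MvPolynomial.coeff e (p j))) (𝓝[>] 0) (𝓝 0) := by
    intro j
    simpa using tendsto_finsetSum (p j).support fun e _ => tendsto_weightedNorm (hc j e) (hp j e)
  have h2 : ∀ᶠ r : ℝ≥0 in 𝓝[>] 0, ∀ j, ∑ e ∈ (p j).support,
      weightedNorm r (MvPolynomial.coeff e (p j)) ≤ 1 :=
    eventually_all.2 fun j => (h1 j).eventually_le_const (by simp)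
  obtain ⟨r, hr, hr0⟩ := (h2.and self_mem_nhdsWithin).exists
  have h3 : ∀ n j, truncNorm r n (w j) ≤ 1 := by
    intro n
    induction n with
    | zero => intro j; simp [truncNorm]
    | succ n ih =>
      intro j
      rw [hw j, MvPolynomial.eval_eq]
      refine (truncNorm_sum_le _ _ _ _).trans (le_trans (Finset.sum_le_sum fun e _ => ?_) (hr j))
      refine (truncNorm_succ_mul_le r n (hp j e) _).trans ?_
      refine mul_le_of_le_one_right zero_le ?_
      exact truncNorm_prod_le_one _ fun i _ => truncNorm_pow_le_one (ih i) _
  exact isConvergent_iff.2 ⟨r, hr0, ((weightedNorm_le fun n => h3 n j).trans_lt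
    ENNReal.one_lt_top).ne⟩

theorem isConvergent_X (i : Fin 2) : IsConvergent (X i : MvPowerSeries (Fin 2) k) := by
  classical
  refine ⟨1, one_pos, summable_of_ne_finset_zero (s := {Finsupp.single i 1}) fun d hd => ?_⟩
  rw [coeff_X, if_neg (by simpa using hd)]
  simp

theorem IsConvergent.of_norm_coeff_le {f g : MvPowerSeries (Fin 2) k} (hf : IsConvergent f)
    (i : Fin 2) (h : ∀ d, ‖coeff d g‖ ≤ ‖coeff (d + Finsupp.single i 1) f‖) :
    IsConvergent g := by
  obtain ⟨r, hr, hf⟩ := hf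
  have hinj : Function.Injective fun d : Fin 2 →₀ ℕ => d + Finsupp.single i 1 :=
    fun a b hab => add_right_cancel hab
  refine ⟨r, hr, Summable.of_nonneg_of_le (fun d => by positivity) (fun d => ?_)
    ((hf.comp_injective hinj).mul_left r⁻¹)⟩
  simp only [Function.comp_apply, map_add, Finsupp.degree_single, pow_succ]
  calc ‖coeff d g‖ * r ^ d.degree ≤ ‖coeff (d + Finsupp.single i 1) f‖ * r ^ d.degree := by
        gcongr; exact h d
    _ = _ := by field_simp

theorem isAdmissible_convergentSeries : IsAdmissible (convergentSeries k) where
  X_mem := isConvergent_X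
  shiftX_mem _ hf := hf.of_norm_coeff_le 0 fun _ => le_rfl
  shiftY_mem _ hf := hf.of_norm_coeff_le 1 fun d => by
    rw [coeff_shiftY]
    split_ifs <;> simp
  exists_eq_eval J _ p hp := by
    have hp' : ∀ j e, constantCoeff (MvPolynomial.coeff e
        (MvPolynomial.map (convergentSeries k).val.toRingHom (p j))) = 0 :=
      fun j e => by rw [MvPolynomial.coeff_map]; exact hp j e
    obtain ⟨w, hw⟩ := PlaneCurveGerm.exists_eq_eval
      (fun j => MvPolynomial.map (convergentSeries k).val.toRingHom (p j)) hp'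
    refine ⟨fun j => ⟨w j, isConvergent_of_eq_eval _ hp' (fun j e => ?_) hw j⟩,
      fun j => Subtype.ext ?_⟩
    · rw [MvPolynomial.coeff_map]
      exact (MvPolynomial.coeff e (p j)).2
    · rw [coe_eval]
      exact hw j

end WeightedNorm

/-! ### Ideals in admissible rings of power series -/

section Admissible

variable {k : Type*} [Field k] {O : Subalgebra k (MvPowerSeries (Fin 2) k)}

/-- With the inverse written as 1 + w, the equation f(1 + w) = 1 becomes w = (1 - f)(1 + w), a
system of the solvable kind. -/
theorem IsAdmissible.isUnit_of_constantCoeff_eq_one (hO : IsAdmissible O) {f : O}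
    (hf : constantCoeff (f : MvPowerSeries (Fin 2) k) = 1) : IsUnit f := by
  obtain ⟨w, hw⟩ := hO.exists_eq_eval Unit
    (fun _ => MvPolynomial.C (1 - f) * (1 + MvPolynomial.X ())) (fun _ e => by
      rw [MvPolynomial.coeff_C_mul]
      simp [hf])
  have h := hw ()
  simp only [map_mul, MvPolynomial.eval_C, map_add, map_one, MvPolynomial.eval_X] at h
  refine IsUnit.of_mul_eq_one (1 + w ()) ?_
  linear_combination h

theorem IsAdmissible.isUnit_of_constantCoeff_ne_zero (hO : IsAdmissible O) {f : O}
    (hf : constantCoeff (f : MvPowerSeries (Fin 2) k) ≠ 0) : IsUnit f := by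
  set c := constantCoeff (f : MvPowerSeries (Fin 2) k) with hc
  have h1 : IsUnit (algebraMap k O c⁻¹ * f) := by
    refine hO.isUnit_of_constantCoeff_eq_one ?_
    rw [MulMemClass.coe_mul, map_mul, ← hc]
    have : constantCoeff ((algebraMap k O c⁻¹ : O) : MvPowerSeries (Fin 2) k) = c⁻¹ :=
      constantCoeff_C _
    rw [this, inv_mul_cancel₀ hf]
  exact isUnit_of_mul_isUnit_right h1

theorem constantCoeff_ne_zero_of_isUnit {f : O} (hf : IsUnit f) :
    constantCoeff (f : MvPowerSeries (Fin 2) k) ≠ 0 :=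
  ((hf.map O.val).map (constantCoeff (σ := Fin 2) (R := k))).ne_zero

/-- The ideal of elements of `O` of order at least `n`. -/
def orderIdealIn (O : Subalgebra k (MvPowerSeries (Fin 2) k)) (n : ℕ) : Ideal O :=
  (orderIdeal k n).comap O.val.toRingHom

theorem mem_orderIdealIn_one {f : O} :
    f ∈ orderIdealIn O 1 ↔ constantCoeff (f : MvPowerSeries (Fin 2) k) = 0 := mem_orderIdeal_one

/-- The coordinate functions as elements of `O`. -/
def IsAdmissible.coord (hO : IsAdmissible O) (i : Fin 2) : O := ⟨X i, hO.X_mem i⟩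

theorem IsAdmissible.coe_coord (hO : IsAdmissible O) (i : Fin 2) :
    (hO.coord i : MvPowerSeries (Fin 2) k) = X i := rfl

theorem IsAdmissible.exists_eq_coord_mul_add (hO : IsAdmissible O) {n : ℕ} {f : O}
    (hf : f ∈ orderIdealIn O (n + 1)) :
    ∃ g ∈ orderIdealIn O n, ∃ h ∈ orderIdealIn O n, f = hO.coord 0 * g + hO.coord 1 * h := by
  refine ⟨⟨_, hO.shiftX_mem _ f.2⟩, shiftX_mem_orderIdeal hf, ⟨_, hO.shiftY_mem _ f.2⟩,
    shiftY_mem_orderIdeal hf, Subtype.ext ?_⟩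
  exact eq_X_mul_shiftX_add (mem_orderIdeal_one.1 (orderIdeal_antitone (by omega) hf))

theorem IsAdmissible.orderIdealIn_le_pow (hO : IsAdmissible O) (n : ℕ) :
    orderIdealIn O n ≤ Ideal.span {hO.coord 0, hO.coord 1} ^ n := by
  induction n with
  | zero => simp
  | succ n ih =>
    intro f hf
    obtain ⟨g, hg, h, hh, rfl⟩ := hO.exists_eq_coord_mul_add hf
    rw [pow_succ']
    exact Ideal.add_mem _ (Ideal.mul_mem_mul (Ideal.subset_span (by simp)) (ih hg))
      (Ideal.mul_mem_mul (Ideal.subset_span (by simp)) (ih hh))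

theorem IsAdmissible.orderIdealIn_one_le_jacobson (hO : IsAdmissible O) :
    orderIdealIn O 1 ≤ Ideal.jacobson ⊥ := by
  intro f hf
  rw [Ideal.mem_jacobson_bot]
  intro g
  refine hO.isUnit_of_constantCoeff_eq_one ?_
  rw [mem_orderIdealIn_one] at hf
  simp [hf]

theorem IsAdmissible.coord_dvd_of_dvd_coord_mul (hO : IsAdmissible O) {f : O}
    (h : hO.coord 0 ∣ hO.coord 1 * f) : hO.coord 0 ∣ f := by
  have h1 : (X 0 : MvPowerSeries (Fin 2) k) ∣ X 1 * (f : MvPowerSeries (Fin 2) k) :=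
    map_dvd O.val h
  have h2 : (X 0 : MvPowerSeries (Fin 2) k) ∣ f := by
    rw [X_dvd_iff] at h1 ⊢
    intro m hm
    have h3 := h1 (Finsupp.single 1 1 + m) (by simp [hm])
    rwa [X_def, coeff_add_monomial_mul, one_mul] at h3
  exact ⟨⟨_, hO.shiftX_mem _ f.2⟩, Subtype.ext (X_mul_shiftX h2).symm⟩

theorem IsAdmissible.coord_ne_zero (hO : IsAdmissible O) (i : Fin 2) : hO.coord i ≠ 0 :=
  fun h => by
    classical
    have := congrArg (fun f : O => coeff (Finsupp.single i 1) (f : MvPowerSeries (Fin 2) k)) h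
    simp [hO.coe_coord, coeff_X] at this

/-- Powers of the two coordinates form a regular sequence: strip the factors y one at a time to
extract one x, cancel it, and repeat. -/
theorem IsAdmissible.coord_pow_dvd_of_dvd_coord_pow_mul (hO : IsAdmissible O) {m n : ℕ} {f : O}
    (h : hO.coord 0 ^ n ∣ hO.coord 1 ^ m * f) : hO.coord 0 ^ n ∣ f := by
  have step : ∀ (m : ℕ) (f : O), hO.coord 0 ∣ hO.coord 1 ^ m * f → hO.coord 0 ∣ f := by
    intro m
    induction m with
    | zero => intro f hf; simpa using hf
    | succ m ih =>
      intro f hf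
      rw [pow_succ', mul_assoc] at hf
      exact ih f (hO.coord_dvd_of_dvd_coord_mul hf)
  induction n generalizing f with
  | zero => simp
  | succ n ih =>
    obtain ⟨g, rfl⟩ := step m f ((Dvd.intro_left _ (pow_succ _ n).symm).trans h)
    rw [pow_succ'] at h ⊢
    refine mul_dvd_mul_left _ (ih ?_)
    rw [mul_left_comm] at h
    exact (mul_dvd_mul_iff_left (hO.coord_ne_zero 0)).1 h

/-- In each binomial term I^i J^(a+b-i), either i ≥ a or a + b - i ≥ b. -/
theorem sup_pow_add_le {R : Type*} [CommRing R] (I J : Ideal R) (a b : ℕ) :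
    (I ⊔ J) ^ (a + b) ≤ I ^ a * (I ⊔ J) ^ b ⊔ J ^ b * (I ⊔ J) ^ a := by
  rw [← Ideal.add_eq_sup, add_pow, Ideal.sum_eq_sup]
  refine Finset.sup_le fun i hi => (Ideal.mul_le_left).trans ?_
  have hi' := Finset.mem_range.1 hi
  rcases le_total a i with h | h
  · refine le_sup_of_le_left ?_
    obtain ⟨c, rfl⟩ := Nat.exists_eq_add_of_le h
    rw [pow_add, mul_assoc]
    refine Ideal.mul_mono_right ?_
    have : b = c + (a + b - (a + c)) := by omega
    conv_rhs => rw [this, pow_add]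
    exact Ideal.mul_mono (Ideal.pow_right_mono le_sup_left _) (Ideal.pow_right_mono le_sup_right _)
  · refine le_sup_of_le_right ?_
    have h1 : a + b - i = b + (a - i) := by omega
    rw [h1, pow_add, mul_left_comm]
    refine Ideal.mul_mono_right ?_
    have : a = i + (a - i) := by omega
    conv_rhs => rw [this, pow_add]
    exact Ideal.mul_mono (Ideal.pow_right_mono le_sup_left _) (Ideal.pow_right_mono le_sup_right _)

/-- Two elements whose lowest order parts are powers of independent linear forms generate an ideal
that contains a power of the maximal ideal. -/
theorem IsAdmissible.pow_le_span_pair (hO : IsAdmissible O) {l₁ l₂ f g : O} {a b : ℕ}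
    (hl : Ideal.span {l₁} ⊔ Ideal.span {l₂} = Ideal.span {hO.coord 0, hO.coord 1})
    (hf : l₁ ^ a ∈ Ideal.span {f} ⊔ Ideal.span {hO.coord 0, hO.coord 1} ^ (a + 1))
    (hg : l₂ ^ b ∈ Ideal.span {g} ⊔ Ideal.span {hO.coord 0, hO.coord 1} ^ (b + 1)) :
    Ideal.span {hO.coord 0, hO.coord 1} ^ (a + b) ≤ Ideal.span {f} ⊔ Ideal.span {g} := by
  have hfg : (Ideal.span {hO.coord 0, hO.coord 1}).FG :=
    Submodule.fg_span (Set.toFinite _)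
  have hjac : Ideal.span {hO.coord 0, hO.coord 1} ≤ Ideal.jacobson ⊥ := by
    refine le_trans ?_ hO.orderIdealIn_one_le_jacobson
    rw [Ideal.span_le]
    rintro z (rfl | rfl) <;> exact mem_orderIdealIn_one.2 (constantCoeff_X _)
  have key : ∀ {l f : O} {a b : ℕ},
      l ^ a ∈ Ideal.span {f} ⊔ Ideal.span {hO.coord 0, hO.coord 1} ^ (a + 1) →
      Ideal.span {l} ^ a * Ideal.span {hO.coord 0, hO.coord 1} ^ b ≤
        Ideal.span {f} ⊔ Ideal.span {hO.coord 0, hO.coord 1} ^ (a + b + 1) := by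
    intro l f a b h
    rw [Ideal.span_singleton_pow]
    refine (Ideal.mul_mono_left ((Ideal.span_singleton_le_iff_mem _).2 h)).trans ?_
    rw [Ideal.sup_mul, ← pow_add]
    refine sup_le_sup Ideal.mul_le_left (le_of_eq ?_)
    congr 1
    omega
  -- Nakayama: with 𝔪 = (x, y), it suffices that 𝔪^(a+b) lies in (f) + (g) + 𝔪·𝔪^(a+b). By
  -- `sup_pow_add_le` only l₁^a 𝔪^b and l₂^b 𝔪^a have to be checked.
  refine Submodule.le_of_le_smul_of_le_jacobson_bot (hfg.pow) hjac ?_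
  conv_lhs => rw [← hl]
  refine (sup_pow_add_le _ _ a b).trans ?_
  rw [hl, smul_eq_mul, ← pow_succ']
  refine sup_le ((key hf).trans ?_) ((key hg).trans ?_)
  · exact sup_le_sup_right le_sup_left _
  · rw [add_comm b a]
    exact sup_le_sup_right le_sup_right _

/-- Two elements whose lowest order parts are powers of independent linear forms form a regular
sequence. -/
theorem IsAdmissible.dvd_of_dvd_mul_right (hO : IsAdmissible O) {l₁ l₂ f g : O} {a b : ℕ}
    (hl : Ideal.span {l₁} ⊔ Ideal.span {l₂} = Ideal.span {hO.coord 0, hO.coord 1})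
    (hf0 : f ≠ 0)
    (hf : l₁ ^ a ∈ Ideal.span {f} ⊔ Ideal.span {hO.coord 0, hO.coord 1} ^ (a + 1))
    (hg : l₂ ^ b ∈ Ideal.span {g} ⊔ Ideal.span {hO.coord 0, hO.coord 1} ^ (b + 1))
    {h : O} (hd : f ∣ h * g) : f ∣ h := by
  have hle := hO.pow_le_span_pair hl hf hg
  -- The powers x^(a+b) and y^(a+b) lie in (f, g), and f divides both f h and g h.
  have key : ∀ i : Fin 2, f ∣ hO.coord i ^ (a + b) * h := by
    intro i
    have h1 : hO.coord i ^ (a + b) ∈ Ideal.span {f} ⊔ Ideal.span {g} :=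
      hle (Ideal.pow_mem_pow (Ideal.subset_span (by fin_cases i <;> simp)) _)
    obtain ⟨s, hs, t, ht, hst⟩ := Submodule.mem_sup.1 h1
    rw [← hst, add_mul]
    refine dvd_add ((Ideal.mem_span_singleton.1 hs).mul_right _) ?_
    obtain ⟨t, rfl⟩ := Ideal.mem_span_singleton.1 ht
    rw [mul_right_comm, mul_comm g h]
    exact hd.mul_right _
  obtain ⟨p, hp⟩ := key 0
  obtain ⟨q, hq⟩ := key 1
  -- Both sides times f equal x^(a+b) y^(a+b) h. Hence x^(a+b) divides p, and it cancels from
  -- x^(a+b) h = f p.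
  have h2 : hO.coord 0 ^ (a + b) * q = hO.coord 1 ^ (a + b) * p := by
    refine mul_left_cancel₀ hf0 ?_
    linear_combination hO.coord 1 ^ (a + b) * hp - hO.coord 0 ^ (a + b) * hq
  obtain ⟨p', rfl⟩ := hO.coord_pow_dvd_of_dvd_coord_pow_mul (Dvd.intro _ h2)
  refine ⟨p', mul_left_cancel₀ (pow_ne_zero (a + b) (hO.coord_ne_zero 0)) ?_⟩
  linear_combination hp

end Admissible

/-! ### Initial forms -/

section InitialForm

variable {k : Type*} [Field k]

theorem coeff_initialForm (f : MvPowerSeries (Fin 2) k) (d : Fin 2 →₀ ℕ) :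
    MvPolynomial.coeff d (initialForm f) = if d.degree = mult f then coeff d f else 0 := by
  classical
  rw [initialForm, MvPolynomial.coeff_sum]
  simp only [MvPolynomial.coeff_monomial]
  rw [Finset.sum_ite_eq']
  refine if_congr ?_ rfl rfl
  rw [Finset.mem_finsuppAntidiag, Finsupp.degree_eq_sum]
  simp

theorem coe_initialForm (f : MvPowerSeries (Fin 2) k) :
    (initialForm f : MvPowerSeries (Fin 2) k) = homogeneousComponent (mult f) f := by
  ext d
  rw [MvPolynomial.coeff_coe, coeff_initialForm, coeff_homogeneousComponent]

theorem coe_mult {f : MvPowerSeries (Fin 2) k} (hf : f ≠ 0) : (mult f : ℕ∞) = f.order :=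
  ne_zero_iff_order_finite.1 hf

theorem initialForm_isHomogeneous (f : MvPowerSeries (Fin 2) k) :
    (initialForm f).IsHomogeneous (mult f) := by
  intro d hd
  rw [coeff_initialForm] at hd
  change Finsupp.weight (fun _ => 1) d = _
  rw [← Finsupp.degree_eq_weight_one]
  by_contra h
  exact hd (if_neg h)

theorem mult_mul {f g : MvPowerSeries (Fin 2) k} (hf : f ≠ 0) (hg : g ≠ 0) :
    mult (f * g) = mult f + mult g := by
  have : (mult (f * g) : ℕ∞) = mult f + mult g := by
    rw [coe_mult (mul_ne_zero hf hg), coe_mult hf, coe_mult hg, order_mul]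
  exact_mod_cast this

theorem initialForm_mul {f g : MvPowerSeries (Fin 2) k} (hf : f ≠ 0) (hg : g ≠ 0) :
    initialForm (f * g) = initialForm f * initialForm g := by
  apply MvPolynomial.coe_injective
  rw [MvPolynomial.coe_mul, coe_initialForm, coe_initialForm, coe_initialForm, mult_mul hf hg,
    homogeneousComponent_mul_of_le_order (coe_mult hf).le (coe_mult hg).le]

theorem sub_initialForm_mem (f : MvPowerSeries (Fin 2) k) :
    f - initialForm f ∈ orderIdeal k (mult f + 1) := by
  rw [mem_orderIdeal_iff_coeff]
  intro d hd
  rw [map_sub, MvPolynomial.coeff_coe, coeff_initialForm]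
  split_ifs with h
  · exact sub_self _
  · rw [sub_zero]
    refine coeff_of_lt_order ?_
    by_cases hf : f = 0
    · simp [hf]
    · rw [← coe_mult hf]
      exact_mod_cast (by omega : d.degree < mult f)

/-- The practical criterion for initial forms: a nonzero candidate of degree m only has to match f
up to order m + 1. -/
theorem mult_and_initialForm_eq {f : MvPowerSeries (Fin 2) k} {m : ℕ} {F : MvPolynomial (Fin 2) k}
    (hF : F.IsHomogeneous m) (hF0 : F ≠ 0) (h : f - F ∈ orderIdeal k (m + 1)) :
    mult f = m ∧ initialForm f = F := by
  rw [mem_orderIdeal_iff_coeff] at h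
  have hc : ∀ d : Fin 2 →₀ ℕ, d.degree < m + 1 → coeff d f = MvPolynomial.coeff d F := by
    intro d hd
    have := h d hd
    rwa [map_sub, sub_eq_zero, MvPolynomial.coeff_coe] at this
  obtain ⟨d, hd⟩ := MvPolynomial.ne_zero_iff.1 hF0
  have hdm : d.degree = m := by
    by_contra hne
    exact hd (hF.coeff_eq_zero hne)
  have hord : f.order = m := by
    refine order_eq_nat.2 ⟨⟨d, ?_, hdm⟩, fun e he => ?_⟩
    · rwa [hc d (by omega)]
    · rw [hc e (by omega), hF.coeff_eq_zero (by omega)]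
  have hm : mult f = m := by rw [mult, hord, ENat.toNat_natCast]
  refine ⟨hm, ?_⟩
  ext e
  rw [coeff_initialForm, hm]
  split_ifs with he
  · exact hc e (by omega)
  · exact (hF.coeff_eq_zero he).symm

theorem mult_and_initialForm_of_constantCoeff_ne_zero {f : MvPowerSeries (Fin 2) k}
    (hf : constantCoeff f ≠ 0) :
    mult f = 0 ∧ initialForm f = MvPolynomial.C (constantCoeff f) := by
  refine mult_and_initialForm_eq (MvPolynomial.isHomogeneous_C _ _) (by simpa using hf) ?_
  rw [zero_add, mem_orderIdeal_one]
  simp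

theorem prod_initialForm {ι : Type*} (s : Finset ι) {f : ι → MvPowerSeries (Fin 2) k}
    (hf : ∀ i ∈ s, f i ≠ 0) :
    mult (∏ i ∈ s, f i) = ∑ i ∈ s, mult (f i) ∧
      initialForm (∏ i ∈ s, f i) = ∏ i ∈ s, initialForm (f i) := by
  classical
  induction s using Finset.induction_on with
  | empty =>
    simpa using mult_and_initialForm_of_constantCoeff_ne_zero
      (f := (1 : MvPowerSeries (Fin 2) k)) (by simp)
  | insert i s hi ih =>
    obtain ⟨h1, h2⟩ := ih fun j hj => hf j (by simp [hj])
    have h3 : ∏ j ∈ s, f j ≠ 0 := Finset.prod_ne_zero_iff.2 fun j hj => hf j (by simp [hj])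
    rw [Finset.prod_insert hi, Finset.sum_insert hi, Finset.prod_insert hi,
      mult_mul (hf i (by simp)) h3, initialForm_mul (hf i (by simp)) h3, h1, h2]
    exact ⟨rfl, rfl⟩

theorem exists_initialForm_eq_of_associated {O : Subalgebra k (MvPowerSeries (Fin 2) k)} {f g : O}
    (h : Associated f g) (hf : f ≠ 0) :
    mult (f : MvPowerSeries (Fin 2) k) = mult (g : MvPowerSeries (Fin 2) k) ∧
      ∃ c : k, c ≠ 0 ∧ initialForm (g : MvPowerSeries (Fin 2) k) =
        initialForm (f : MvPowerSeries (Fin 2) k) * MvPolynomial.C c := by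
  obtain ⟨u, rfl⟩ := h
  have hu := constantCoeff_ne_zero_of_isUnit u.isUnit
  have hu0 : ((u : O) : MvPowerSeries (Fin 2) k) ≠ 0 := by
    intro h; rw [h] at hu; simp at hu
  have hf' : (f : MvPowerSeries (Fin 2) k) ≠ 0 := by simpa using hf
  obtain ⟨h1, h2⟩ := mult_and_initialForm_of_constantCoeff_ne_zero hu
  rw [MulMemClass.coe_mul, mult_mul hf' hu0, initialForm_mul hf' hu0, h1, h2]
  exact ⟨rfl, _, hu, rfl⟩

theorem tangentCone_eq_of_associated {O : Subalgebra k (MvPowerSeries (Fin 2) k)} {f g : O}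
    (h : Associated f g) (hf : f ≠ 0) :
    tangentCone (f : MvPowerSeries (Fin 2) k) = tangentCone (g : MvPowerSeries (Fin 2) k) := by
  obtain ⟨-, c, hc, h1⟩ := exists_initialForm_eq_of_associated h hf
  ext v
  simp [tangentCone, h1, hc]

theorem tangentCone_prod {ι : Type*} (s : Finset ι) {f : ι → MvPowerSeries (Fin 2) k}
    (hf : ∀ i ∈ s, f i ≠ 0) :
    tangentCone (∏ i ∈ s, f i) = ⋃ i ∈ s, tangentCone (f i) := by
  ext v
  simp [tangentCone, (prod_initialForm s hf).2, map_prod, Finset.prod_eq_zero_iff]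

/-- A nonzero point of a line inside the union lies on some member, and lines through 0 sharing a
nonzero point coincide. -/
theorem tangentLines_eq_range {ι : Type*} {f : MvPowerSeries (Fin 2) k}
    {L : ι → Submodule k (Fin 2 → k)} (hL : ∀ i, Module.finrank k (L i) = 1)
    (h : tangentCone f = ⋃ i, (L i : Set (Fin 2 → k))) : tangentLines f = Set.range L := by
  ext K
  constructor
  · rintro ⟨hK, hKf⟩
    obtain ⟨v, hv, hv0⟩ := Submodule.exists_mem_ne_zero_of_ne_bot
      (p := K) (by rintro rfl; simp at hK)
    have hvf := hKf hv
    rw [h, Set.mem_iUnion] at hvf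
    obtain ⟨i, hi⟩ := hvf
    refine ⟨i, ?_⟩
    have aux : ∀ P : Submodule k (Fin 2 → k), Module.finrank k P = 1 → v ∈ P →
        Submodule.span k {v} = P := fun P hP hvP =>
      Submodule.eq_of_le_of_finrank_eq ((Submodule.span_singleton_le_iff_mem _ _).2 hvP)
        (by rw [finrank_span_singleton hv0, hP])
    rw [← aux _ (hL i) hi, aux K hK hv]
  · rintro ⟨i, rfl⟩
    exact ⟨hL i, h ▸ Set.subset_iUnion (fun i => (L i : Set (Fin 2 → k))) i⟩

end InitialForm

/-! ### Pencils of lines -/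

section Pencil

variable {k : Type*} [Field k]

theorem prime_of_isHomogeneous_one {σ : Type*} {F : MvPolynomial σ k} (hF : F.IsHomogeneous 1)
    (hF0 : F ≠ 0) : Prime F := by
  refine (MvPolynomial.irreducible_of_totalDegree_eq_one (hF.totalDegree hF0) ?_).prime
  intro x hx
  obtain ⟨d, hd⟩ := MvPolynomial.ne_zero_iff.1 hF0
  exact isUnit_iff_ne_zero.2 fun h => hd (by simpa [h] using hx d)

/-- The linear form `u + μ v`, where `u = d x - c y` and `v = a y - b x`. -/
def pencilForm (a b c d μ : k) : MvPolynomial (Fin 2) k :=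
  MvPolynomial.C (d - μ * b) * MvPolynomial.X 0 + MvPolynomial.C (μ * a - c) * MvPolynomial.X 1

/-- The line `u + μ v = 0`, where `u = d x - c y` and `v = a y - b x`. -/
def pencilLine (a b c d μ : k) : Submodule k (Fin 2 → k) :=
  Submodule.span k {![c - μ * a, d - μ * b]}

theorem pencilForm_isHomogeneous (a b c d μ : k) : (pencilForm a b c d μ).IsHomogeneous 1 :=
  (MvPolynomial.isHomogeneous_C_mul_X _ _).add (MvPolynomial.isHomogeneous_C_mul_X _ _)

theorem eval_pencilForm (a b c d μ : k) (s : Fin 2 → k) :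
    MvPolynomial.eval s (pencilForm a b c d μ) = (d - μ * b) * s 0 + (μ * a - c) * s 1 := by
  simp [pencilForm]

variable {a b c d : k}

theorem pencilForm_ne_zero (hdet : a * d - b * c = 1) (μ : k) : pencilForm a b c d μ ≠ 0 := by
  -- At the point (a, b) the form u is 1 and v is 0, so every form of the pencil takes the value 1.
  intro h
  have h1 := eval_pencilForm a b c d μ ![a, b]
  rw [h] at h1
  simp only [map_zero, Matrix.cons_val_zero, Matrix.cons_val_one] at h1
  refine one_ne_zero (α := k) ?_
  linear_combination -hdet - h1

theorem pencilForm_prime (hdet : a * d - b * c = 1) (μ : k) : Prime (pencilForm a b c d μ) :=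
  prime_of_isHomogeneous_one (pencilForm_isHomogeneous a b c d μ) (pencilForm_ne_zero hdet μ)

theorem mem_pencilLine (hdet : a * d - b * c = 1) {μ : k} {s : Fin 2 → k} :
    s ∈ pencilLine a b c d μ ↔ MvPolynomial.eval s (pencilForm a b c d μ) = 0 := by
  rw [eval_pencilForm, pencilLine, Submodule.mem_span_singleton]
  constructor
  · rintro ⟨t, rfl⟩
    simp only [Pi.smul_apply, Matrix.cons_val_zero, Matrix.cons_val_one, smul_eq_mul]
    ring
  · intro h
    -- The form v = a y - b x equals ad - bc = 1 at the spanning vector, so v(s) is the only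
    -- possible coefficient.
    refine ⟨a * s 1 - b * s 0, ?_⟩
    ext i
    fin_cases i
    · change (a * s 1 - b * s 0) * (c - μ * a) = s 0
      linear_combination s 0 * hdet - a * h
    · change (a * s 1 - b * s 0) * (d - μ * b) = s 1
      linear_combination s 1 * hdet - b * h

theorem finrank_pencilLine (hdet : a * d - b * c = 1) (μ : k) :
    Module.finrank k (pencilLine a b c d μ) = 1 := by
  refine finrank_span_singleton fun h => one_ne_zero (α := k) ?_
  have h0 := congrFun h 0
  have h1 := congrFun h 1
  simp only [Matrix.cons_val_zero, Matrix.cons_val_one, Pi.zero_apply] at h0 h1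
  linear_combination -hdet + a * h1 - b * h0

theorem eq_of_pencilLine_le (hdet : a * d - b * c = 1) {μ ν : k}
    (h : pencilLine a b c d μ ≤ pencilLine a b c d ν) :
    μ = ν := by
  have h1 := h (Submodule.mem_span_singleton_self _)
  -- The form with parameter ν takes the value ν - μ at the spanning vector of the line with
  -- parameter μ.
  rw [mem_pencilLine hdet, eval_pencilForm] at h1
  simp only [Matrix.cons_val_zero, Matrix.cons_val_one] at h1
  linear_combination (ν - μ) * hdet - h1

/-- A divisor of a product of powers of linear forms of a pencil, whose zero set is one line
of the pencil, is a power of the corresponding linear form. -/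
theorem exists_eq_C_mul_pencilForm_pow (hdet : a * d - b * c = 1)
    {ι : Type*} {s : Finset ι} {μ : ι → k} {m : ι → ℕ}
    {F : MvPolynomial (Fin 2) k} {n : ℕ} (hF : F.IsHomogeneous n) {i : ι} (hi : i ∈ s)
    (hμ : ∀ j ∈ s, μ j = μ i → j = i)
    (hdvd : F ∣ ∏ j ∈ s, pencilForm a b c d (μ j) ^ m j)
    (hzero : ∀ v, MvPolynomial.eval v F = 0 → v ∈ pencilLine a b c d (μ i)) :
    ∃ t : k, t ≠ 0 ∧ F = MvPolynomial.C t * pencilForm a b c d (μ i) ^ n := by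
  classical
  rw [← Finset.mul_prod_erase s _ hi] at hdvd
  -- If another linear form divided F, its whole line would lie in the zero set of F, which is
  -- contained in the line of `μ i`.
  have hrel : ∀ j ∈ s.erase i, IsRelPrime F (pencilForm a b c d (μ j) ^ m j) := by
    intro j hj
    refine IsRelPrime.pow_right (IsRelPrime.symm ?_)
    refine ((pencilForm_prime hdet (μ j)).irreducible.isRelPrime_iff_not_dvd).2 ?_
    rintro ⟨G, rfl⟩
    have hle : pencilLine a b c d (μ j) ≤ pencilLine a b c d (μ i) := by
      intro v hv
      refine hzero v ?_
      rw [map_mul, (mem_pencilLine hdet).1 hv, zero_mul]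
    exact (Finset.mem_erase.1 hj).1
      (hμ j (Finset.mem_erase.1 hj).2 (eq_of_pencilLine_le hdet hle))
  have h1 : F ∣ pencilForm a b c d (μ i) ^ m i :=
    (IsRelPrime.prod_right hrel).dvd_of_dvd_mul_right hdvd
  obtain ⟨e, -, he⟩ := (dvd_prime_pow (pencilForm_prime hdet (μ i)) _).1 h1
  obtain ⟨u, hu⟩ := he.symm
  obtain ⟨t, ht, htu⟩ := MvPolynomial.isUnit_iff_eq_C_of_isReduced.1 u.isUnit
  have hF' : F = MvPolynomial.C t * pencilForm a b c d (μ i) ^ e := by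
    rw [← hu, htu, mul_comm]
  have hF0 : F ≠ 0 := by
    rw [hF']
    exact mul_ne_zero (by simpa using ht.ne_zero) (pow_ne_zero _ (pencilForm_ne_zero hdet _))
  have he : e = n := by
    have h2 : F.IsHomogeneous e := by
      rw [hF']
      simpa using (((pencilForm_isHomogeneous a b c d (μ i)).pow e).C_mul t)
    exact h2.inj_right hF hF0
  exact ⟨t, ht.ne_zero, he ▸ hF'⟩

end Pencil

/-! ### Jordan decomposition of matrices -/

section Jordan

variable {k : Type*} [Field k] {n : Type*} [Fintype n] [DecidableEq n]

/-- Every matrix over an algebraically closed field is conjugate to the sum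
of a diagonal matrix and of a nilpotent matrix that commutes with it. -/
theorem exists_conj_diagonal_add_nilpotent [IsAlgClosed k] (Q : Matrix n n k) :
    ∃ (P : (Matrix n n k)ˣ) (b : n → k) (N : Matrix n n k), IsNilpotent N ∧
      Commute (Matrix.diagonal b) N ∧ Q * P = P * (Matrix.diagonal b + N) := by
  classical
  set f := Matrix.toLin' Q with hf
  -- Jordan–Chevalley decomposition; over an algebraically closed field the semisimple part has an
  -- eigenbasis, which gives the columns of P.
  obtain ⟨ν, hν, s, hs, hνnil, hss, hfs⟩ :=
    Module.End.exists_isNilpotent_isSemisimple (f := f)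
  have hcomm : Commute s ν := by
    have h1 : Commute f s := Algebra.commute_of_mem_adjoin_self hs
    exact (Algebra.commute_of_mem_adjoin_singleton_of_commute hν h1.symm)
  have hint : DirectSum.IsInternal s.eigenspace :=
    DirectSum.isInternal_submodule_of_iSupIndep_of_iSup_eq_top s.eigenspaces_iSupIndep
      hss.iSup_eigenspace_eq_top
  set B₀ := hint.collectedBasis fun μ => Module.finBasis k (s.eigenspace μ) with hB₀
  set e := B₀.indexEquiv (Pi.basisFun k n) with he
  set B := B₀.reindex e with hB
  have hsB : ∀ j, s (B j) = (e.symm j).1 • B j := by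
    intro j
    rw [hB, Module.Basis.reindex_apply]
    exact Module.End.mem_eigenspace_iff.1 (hint.collectedBasis_mem _ (e.symm j))
  have hdiag : LinearMap.toMatrix B B s = Matrix.diagonal fun j => (e.symm j).1 := by
    ext i j
    rw [LinearMap.toMatrix_apply, hsB, map_smul, Finsupp.smul_apply, Module.Basis.repr_self,
      Matrix.diagonal_apply, Finsupp.single_apply]
    by_cases hij : i = j
    · subst hij; simp
    · rw [if_neg hij, if_neg (Ne.symm hij), smul_zero]
  refine ⟨⟨(Pi.basisFun k n).toMatrix B, B.toMatrix (Pi.basisFun k n),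
    Module.Basis.toMatrix_mul_toMatrix_flip _ _, Module.Basis.toMatrix_mul_toMatrix_flip _ _⟩,
    fun j => (e.symm j).1, LinearMap.toMatrix B B ν, ?_, ?_, ?_⟩
  · exact hνnil.map (LinearMap.toMatrixAlgEquiv B)
  · rw [← hdiag]
    exact hcomm.map (LinearMap.toMatrixAlgEquiv B)
  · rw [← hdiag, ← map_add, add_comm s ν, ← hfs, basis_toMatrix_mul_linearMap_toMatrix]
    have : Q = LinearMap.toMatrix (Pi.basisFun k n) (Pi.basisFun k n) f := by
      rw [hf, LinearMap.toMatrix_eq_toMatrix', LinearMap.toMatrix'_toLin']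
    rw [this]
    exact linearMap_toMatrix_mul_basis_toMatrix _ _ _ _

theorem apply_eq_zero_of_commute_diagonal {b : n → k} {N : Matrix n n k}
    (h : Commute (Matrix.diagonal b) N) {i j : n} (hij : b i ≠ b j) : N i j = 0 := by
  have h1 := congrFun (congrFun h.eq i) j
  rw [Matrix.diagonal_mul, Matrix.mul_diagonal, mul_comm, ← sub_eq_zero, ← mul_sub] at h1
  exact (mul_eq_zero.1 h1).resolve_right (sub_ne_zero.2 hij)

end Jordan

/-! ### Block diagonalization -/

section Sylvester

/-- The block diagonal part of a matrix, for the blocks given by the fibres of `b`. -/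
def blockPart {n ι A : Type*} [DecidableEq ι] [Zero A] (b : n → ι) (Y : Matrix n n A) :
    Matrix n n A :=
  Matrix.of fun i j => if b i = b j then Y i j else 0

theorem blockPart_apply {n ι A : Type*} [DecidableEq ι] [Zero A] (b : n → ι) (Y : Matrix n n A)
    (i j : n) : blockPart b Y i j = if b i = b j then Y i j else 0 := rfl

theorem blockPart_map {n ι A B : Type*} [DecidableEq ι] [Semiring A] [Semiring B] (b : n → ι)
    (f : A →+* B) (Y : Matrix n n A) : (blockPart b Y).map f = blockPart b (Y.map f) := by
  ext i j
  simp only [Matrix.map_apply, blockPart_apply]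
  split_ifs <;> simp

variable {k : Type*} [Field k] {n : Type*}

/-- The matrices with vanishing diagonal blocks, for the blocks given by the fibres of `b`. -/
def offBlock (b : n → k) : Submodule k (Matrix n n k) where
  carrier := {Z | ∀ i j, b i = b j → Z i j = 0}
  zero_mem' := fun _ _ _ => rfl
  add_mem' := fun hY hZ i j h => by simp [hY i j h, hZ i j h]
  smul_mem' := fun c Z hZ i j h => by simp [hZ i j h]

variable [Fintype n] [DecidableEq n]

/-- The Sylvester operator of a matrix with Jordan decomposition `diagonal b + N` is invertible on
the matrices with vanishing diagonal blocks. -/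
theorem exists_sylvester_inverse [DecidableEq k] {b : n → k} {N : Matrix n n k} (hN : IsNilpotent N)
    (hb : Commute (Matrix.diagonal b) N) :
    ∃ S : Matrix n n k →ₗ[k] Matrix n n k, (∀ Y i j, b i = b j → S Y i j = 0) ∧
      ∀ Y, (Matrix.diagonal b + N) * S Y - S Y * (Matrix.diagonal b + N) = Y - blockPart b Y := by
  set D := Matrix.diagonal b + N with hD
  let ad : Matrix n n k → Module.End k (Matrix n n k) :=
    fun M => LinearMap.mulLeft k M - LinearMap.mulRight k M
  have had : ∀ M Z, ad M Z = M * Z - Z * M := fun M Z => rfl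
  have hDmul : ∀ i j, b i ≠ b j → D i j = 0 := by
    intro i j hij
    have : i ≠ j := fun h => hij (h ▸ rfl)
    rw [hD, Matrix.add_apply, Matrix.diagonal_apply_ne _ this,
      apply_eq_zero_of_commute_diagonal hb hij, add_zero]
  have hmaps : ∀ Z ∈ offBlock b, ad D Z ∈ offBlock b := by
    intro Z hZ i j hij
    rw [had, Matrix.sub_apply, Matrix.mul_apply, Matrix.mul_apply, Finset.sum_eq_zero,
      Finset.sum_eq_zero, sub_zero]
    · intro t _
      by_cases h : b t = b j
      · rw [hZ i t (hij.trans h.symm), zero_mul]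
      · rw [hDmul t j h, mul_zero]
    · intro t _
      by_cases h : b i = b t
      · rw [hZ t j (h.symm.trans hij), mul_zero]
      · rw [hDmul i t h, zero_mul]
  have hpow : ∀ (m : ℕ) Z i j, (ad (Matrix.diagonal b) ^ m) Z i j = (b i - b j) ^ m * Z i j := by
    intro m
    induction m with
    | zero => intro Z i j; simp
    | succ m ih =>
      intro Z i j
      rw [pow_succ, Module.End.mul_apply, ih, had, Matrix.sub_apply, Matrix.diagonal_mul,
        Matrix.mul_diagonal]
      ring
  have hNnil : IsNilpotent (ad N) :=
    (LinearMap.commute_mulLeft_right N N).isNilpotent_sub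
      ((LinearMap.isNilpotent_mulLeft_iff k N).2 hN)
      ((LinearMap.isNilpotent_mulRight_iff k N).2 hN)
  have hadcomm : Commute (ad (Matrix.diagonal b)) (ad N) := by
    refine LinearMap.ext fun Z => ?_
    simp only [Module.End.mul_apply, had]
    have h := hb.eq
    noncomm_ring
    simp only [← mul_assoc, h]
    simp only [mul_assoc]
    abel
  -- On the kernel of ad D, the operator ad(diagonal b) acts as -ad N. The two commute, so some
  -- power of ad(diagonal b) kills Z; but that power multiplies the entry (i, j) by a power of b i -
  -- b j, nonzero off the blocks.
  have hinj : ∀ Z ∈ offBlock b, ad D Z = 0 → Z = 0 := by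
    intro Z hZ h0
    have h1 : ad (Matrix.diagonal b) Z = -ad N Z := by
      rw [had, hD] at h0
      rw [had, had, eq_neg_iff_add_eq_zero, ← h0]
      noncomm_ring
    have h2 : ∀ m : ℕ, (ad (Matrix.diagonal b) ^ m) Z = (-1 : k) ^ m • (ad N ^ m) Z := by
      intro m
      induction m with
      | zero => simp
      | succ m ih =>
        rw [pow_succ', Module.End.mul_apply, ih, map_smul, ← Module.End.mul_apply,
          (hadcomm.pow_right m).eq, Module.End.mul_apply, h1, map_neg, pow_succ (ad N),
          Module.End.mul_apply, pow_succ, mul_neg_one, neg_smul, smul_neg]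
    obtain ⟨m, hm⟩ := hNnil
    ext i j
    by_cases hij : b i = b j
    · exact hZ i j hij
    · have h3 := congrFun (congrFun (h2 m) i) j
      rw [hm, hpow] at h3
      simpa [sub_ne_zero.2 hij] using h3
  let T : offBlock b →ₗ[k] offBlock b := (ad D).restrict hmaps
  have hTinj : Function.Injective T := by
    rw [injective_iff_map_eq_zero]
    intro Z hZ
    exact Subtype.ext (hinj Z Z.2 (congrArg Subtype.val hZ))
  let E := LinearEquiv.ofInjectiveEndo T hTinj
  let ρ : Matrix n n k →ₗ[k] offBlock b :=
    { toFun := fun Y => ⟨Y - blockPart b Y, fun i j h => by simp [blockPart_apply, h]⟩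
      map_add' := fun Y Z => by
        ext i j
        simp only [Matrix.sub_apply, blockPart_apply, Matrix.add_apply, Submodule.coe_add]
        split_ifs <;> ring
      map_smul' := fun c Y => by
        ext i j
        simp only [Matrix.sub_apply, blockPart_apply, Matrix.smul_apply, Submodule.coe_smul,
          RingHom.id_apply, smul_eq_mul]
        split_ifs <;> ring }
  refine ⟨(offBlock b).subtype ∘ₗ E.symm.toLinearMap ∘ₗ ρ, fun Y i j h => (E.symm (ρ Y)).2 i j h,
    fun Y => ?_⟩
  have h1 : T (E.symm (ρ Y)) = ρ Y := E.apply_symm_apply (ρ Y)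
  exact congrArg Subtype.val h1

/-- The extension of scalars along `φ` of an operator on matrices. -/
def extendOperator (S : Matrix n n k →ₗ[k] Matrix n n k) {A : Type*} [CommRing A] (φ : k →+* A)
    (Y : Matrix n n A) : Matrix n n A :=
  ∑ l, ∑ m, Y l m • (S (Matrix.single l m 1)).map φ

theorem extendOperator_apply (S : Matrix n n k →ₗ[k] Matrix n n k) {A : Type*} [CommRing A]
    (φ : k →+* A) (Y : Matrix n n A) (i j : n) :
    extendOperator S φ Y i j = ∑ l, ∑ m, Y l m * φ (S (Matrix.single l m 1) i j) := by
  simp [extendOperator, Matrix.sum_apply]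

theorem extendOperator_map (S : Matrix n n k →ₗ[k] Matrix n n k) {A B : Type*} [CommRing A]
    [CommRing B] (φ : k →+* A) (f : A →+* B) (Y : Matrix n n A) :
    (extendOperator S φ Y).map f = extendOperator S (f.comp φ) (Y.map f) := by
  ext i j
  simp [extendOperator_apply]

/-- Both sides are linear over A in Y, so the identity reduces to matrix units, where it is the
image of the identity over k. -/
theorem extendOperator_sylvester [DecidableEq k] {b : n → k} {D : Matrix n n k}
    {S : Matrix n n k →ₗ[k] Matrix n n k}
    (hS : ∀ Y, D * S Y - S Y * D = Y - blockPart b Y) {A : Type*} [CommRing A] (φ : k →+* A)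
    (Y : Matrix n n A) :
    D.map φ * extendOperator S φ Y - extendOperator S φ Y * D.map φ = Y - blockPart b Y := by
  have h1 : ∀ l m, D.map φ * (Y l m • (S (Matrix.single l m 1)).map φ) -
      (Y l m • (S (Matrix.single l m 1)).map φ) * D.map φ =
      Matrix.single l m (Y l m) - blockPart b (Matrix.single l m (Y l m)) := by
    intro l m
    rw [Matrix.mul_smul, Matrix.smul_mul, ← smul_sub, ← Matrix.map_mul, ← Matrix.map_mul,
      ← Matrix.map_sub φ (map_sub φ), hS]
    ext i j
    simp only [Matrix.smul_apply, Matrix.map_apply, Matrix.sub_apply, blockPart_apply,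
      Matrix.single_apply, smul_eq_mul]
    split_ifs <;> simp
  rw [extendOperator, Finset.mul_sum, Finset.sum_mul, ← Finset.sum_sub_distrib]
  simp_rw [Finset.mul_sum, Finset.sum_mul, ← Finset.sum_sub_distrib, h1]
  ext i j
  simp only [Matrix.sum_apply, Matrix.sub_apply, blockPart_apply]
  simp only [Finset.sum_sub_distrib]
  have h2 : ∑ l, ∑ m, Matrix.single l m (Y l m) i j = Y i j := by
    conv_rhs => rw [Matrix.matrix_eq_sum_single Y]
    simp only [Matrix.sum_apply]
  by_cases h : b i = b j
  · simp only [if_pos h, h2]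
  · simp only [if_neg h, h2, Finset.sum_const_zero]

end Sylvester

/-! ### Matrices over admissible rings -/

section Riccati

variable {k : Type*} [Field k] {O : Subalgebra k (MvPowerSeries (Fin 2) k)}

/-- The value at the origin, as a ring homomorphism. -/
def evalZero (O : Subalgebra k (MvPowerSeries (Fin 2) k)) : O →+* k :=
  (constantCoeff (σ := Fin 2) (R := k)).comp O.val.toRingHom

theorem evalZero_apply (f : O) : evalZero O f = constantCoeff (f : MvPowerSeries (Fin 2) k) := rfl

theorem evalZero_comp_algebraMap : (evalZero O).comp (algebraMap k O) = RingHom.id k :=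
  RingHom.ext fun c => constantCoeff_C (σ := Fin 2) c

theorem map_algebraMap_map_evalZero {n : Type*} (P : Matrix n n k) :
    (P.map (algebraMap k O)).map (evalZero O) = P := by
  ext i j
  exact RingHom.congr_fun (evalZero_comp_algebraMap (O := O)) (P i j)

variable {n : Type*} [Fintype n] [DecidableEq n]

theorem IsAdmissible.isUnit_of_isUnit_map_evalZero (hO : IsAdmissible O) {M : Matrix n n O}
    (hM : IsUnit (M.map (evalZero O))) : IsUnit M := by
  rw [Matrix.isUnit_iff_isUnit_det] at hM ⊢
  refine hO.isUnit_of_constantCoeff_ne_zero ?_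
  have h : evalZero O M.det = (M.map (evalZero O)).det := RingHom.map_det _ _
  rw [← evalZero_apply, h]
  exact hM.ne_zero

/-- The operator whose fixed points conjugate `D + R` to a block diagonal matrix, where `S` is an
inverse of the Sylvester operator of `D`. -/
def riccati [DecidableEq k] (S : Matrix n n k →ₗ[k] Matrix n n k) (b : n → k) {A : Type*}
    [CommRing A] (φ : k →+* A) (R X : Matrix n n A) : Matrix n n A :=
  extendOperator S φ (X * blockPart b (R + R * X) - (R + R * X))

/-- Naturality lets one formula serve over the polynomial ring in the unknown entries, after
substituting a solution, and after restricting the coefficients to the origin. -/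
theorem riccati_map [DecidableEq k] (S : Matrix n n k →ₗ[k] Matrix n n k) (b : n → k)
    {A B : Type*} [CommRing A] [CommRing B] (φ : k →+* A) (f : A →+* B) (R X : Matrix n n A) :
    (riccati S b φ R X).map f = riccati S b (f.comp φ) (R.map f) (X.map f) := by
  have h : (R + R * X).map f = R.map f + R.map f * X.map f := by
    rw [Matrix.map_add f (map_add f), Matrix.map_mul]
  rw [riccati, riccati, extendOperator_map, Matrix.map_sub f (map_sub f), Matrix.map_mul,
    blockPart_map, h]

/-- Applied at the origin, where R vanishes, this shows that all coefficients of the system have no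
constant term. -/
theorem riccati_zero [DecidableEq k] (S : Matrix n n k →ₗ[k] Matrix n n k) (b : n → k)
    {A : Type*} [CommRing A] (φ : k →+* A) (X : Matrix n n A) : riccati S b φ 0 X = 0 := by
  ext i j
  simp [riccati, extendOperator_apply, blockPart_apply, Matrix.mul_apply]

/-- A matrix over an admissible ring whose value at the origin has Jordan decomposition
`diagonal b + N` is conjugate to a block diagonal matrix with one block for each value of `b`. -/
theorem IsAdmissible.exists_block_conj (hO : IsAdmissible O) {n : Type} [Fintype n]
    [DecidableEq n] {b : n → k} {N : Matrix n n k} (hN : IsNilpotent N)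
    (hb : Commute (Matrix.diagonal b) N) {Q : Matrix n n O}
    (hQ : Q.map (evalZero O) = Matrix.diagonal b + N) :
    ∃ (U : (Matrix n n O)ˣ) (Λ : Matrix n n O), (∀ i j, b i ≠ b j → Λ i j = 0) ∧
      Λ.map (evalZero O) = Matrix.diagonal b + N ∧ Q * U = U * Λ := by
  classical
  obtain ⟨S, hSoff, hS⟩ := exists_sylvester_inverse hN hb
  set D := Matrix.diagonal b + N with hD
  set R := Q - D.map (algebraMap k O) with hRdef
  have hR : R.map (evalZero O) = 0 := by
    rw [hRdef, Matrix.map_sub _ (map_sub _), hQ, map_algebraMap_map_evalZero, sub_self]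
  -- Seek U = 1 + X with X zero on the diagonal blocks and Q U = U (D + Λ), Λ block diagonal. The
  -- equation reads DX - XD = XΛ - (R + RX) + Λ. As XΛ has no diagonal blocks, Λ must be the block
  -- part of R + RX; inverting the Sylvester operator leaves a polynomial fixed-point system for X.
  let W : Matrix n n (MvPolynomial (n × n) O) := Matrix.of fun i j => MvPolynomial.X (i, j)
  let p : n × n → MvPolynomial (n × n) O := fun ij =>
    riccati S b (MvPolynomial.C.comp (algebraMap k O)) (R.map MvPolynomial.C) W ij.1 ij.2
  have hp : ∀ ij e, constantCoeff
      ((MvPolynomial.coeff e (p ij) : O) : MvPowerSeries (Fin 2) k) = 0 := by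
    intro ij e
    have h1 := congrFun (congrFun (riccati_map S b (MvPolynomial.C.comp (algebraMap k O))
      (MvPolynomial.map (evalZero O)) (R.map MvPolynomial.C) W) ij.1) ij.2
    have h2 : (R.map (MvPolynomial.C (σ := n × n))).map (MvPolynomial.map (evalZero O)) = 0 := by
      refine Matrix.ext fun i j => ?_
      have : evalZero O (R i j) = 0 := congrFun (congrFun hR i) j
      simp [this]
    rw [h2, riccati_zero] at h1
    rw [← evalZero_apply, ← MvPolynomial.coeff_map]
    change MvPolynomial.map (evalZero O) (p ij) = 0 at h1
    rw [h1, MvPolynomial.coeff_zero]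
  obtain ⟨w, hw⟩ := hO.exists_eq_eval (n × n) p hp
  let X : Matrix n n O := Matrix.of fun i j => w (i, j)
  have hX : X = riccati S b (algebraMap k O) R X := by
    have h1 := riccati_map S b (MvPolynomial.C.comp (algebraMap k O))
      (MvPolynomial.eval w) (R.map MvPolynomial.C) W
    have h2 : (R.map (MvPolynomial.C (σ := n × n))).map (MvPolynomial.eval w) = R := by
      refine Matrix.ext fun i j => ?_
      simp
    have h3 : W.map (MvPolynomial.eval w) = X := by
      refine Matrix.ext fun i j => ?_
      simp [W, X]
    have h4 : (MvPolynomial.eval w).comp (MvPolynomial.C.comp (algebraMap k O)) =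
        algebraMap k O := by
      ext c : 1
      simp
    rw [h2, h3, h4] at h1
    rw [← h1]
    refine Matrix.ext fun i j => ?_
    exact hw (i, j)
  have hX0 : X.map (evalZero O) = 0 := by
    rw [hX, riccati_map, hR, riccati_zero]
  have hsyl := extendOperator_sylvester hS (algebraMap k O)
    (X * blockPart b (R + R * X) - (R + R * X))
  rw [← riccati, ← hX] at hsyl
  have hU : IsUnit (1 + X) := by
    refine hO.isUnit_of_isUnit_map_evalZero ?_
    rw [Matrix.map_add _ (map_add _), hX0, add_zero, Matrix.map_one _ (map_zero _) (map_one _)]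
    exact isUnit_one
  have hXoff : ∀ i j, b i = b j → X i j = 0 := by
    intro i j hij
    rw [hX, riccati, extendOperator_apply]
    exact Finset.sum_eq_zero fun l _ => Finset.sum_eq_zero fun m _ => by
      rw [hSoff _ i j hij, map_zero, mul_zero]
  have hblock : blockPart b (X * blockPart b (R + R * X)) = 0 := by
    refine Matrix.ext fun i j => ?_
    rw [blockPart_apply, Matrix.zero_apply]
    split_ifs with h
    · rw [Matrix.mul_apply]
      refine Finset.sum_eq_zero fun t _ => ?_
      rw [blockPart_apply]
      split_ifs with h'
      · rw [hXoff i t (h.trans h'.symm), zero_mul]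
      · rw [mul_zero]
    · rfl
  obtain ⟨U, hU⟩ := hU
  refine ⟨U, D.map (algebraMap k O) + blockPart b (R + R * X), fun i j hij => ?_, ?_, ?_⟩
  · have hne : i ≠ j := fun h => hij (h ▸ rfl)
    rw [Matrix.add_apply, Matrix.map_apply, hD, Matrix.add_apply, Matrix.diagonal_apply_ne _ hne,
      apply_eq_zero_of_commute_diagonal hb hij, blockPart_apply, if_neg hij]
    simp
  · rw [Matrix.map_add _ (map_add _), map_algebraMap_map_evalZero, blockPart_map,
      Matrix.map_add _ (map_add _), Matrix.map_mul, hR, hX0]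
    ext i j
    simp [blockPart_apply]
  · have hQ' : Q = D.map (algebraMap k O) + R := by rw [hRdef]; abel
    have hsub : blockPart b (X * blockPart b (R + R * X) - (R + R * X)) =
        -blockPart b (R + R * X) := by
      refine Matrix.ext fun i j => ?_
      have := congrFun (congrFun hblock i) j
      simp only [blockPart_apply, Matrix.sub_apply, Matrix.neg_apply, Matrix.zero_apply] at this ⊢
      split_ifs at this ⊢ with h
      · rw [this, zero_sub]
      · simp
    rw [hsub] at hsyl
    rw [hU, hQ']
    set Dm := D.map (algebraMap k O)
    set Λ := blockPart b (R + R * X)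
    have h5 : Dm * X = X * Dm + (X * Λ - (R + R * X) - -Λ) := by rw [← hsyl]; abel
    rw [mul_add, mul_one, add_mul, h5]
    noncomm_ring

end Riccati

/-! ### Reduction to a linear pencil and the lowest form of a block determinant -/

section NormalForm

variable {k : Type*} [Field k]

theorem prod_mem_orderIdeal {ι : Type*} (s : Finset ι) {f : ι → MvPowerSeries (Fin 2) k}
    (hf : ∀ i ∈ s, f i ∈ orderIdeal k 1) : ∏ i ∈ s, f i ∈ orderIdeal k s.card := by
  classical
  induction s using Finset.induction_on with
  | empty => simp [mem_orderIdeal]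
  | insert i s hi ih =>
    rw [Finset.prod_insert hi, Finset.card_insert_of_notMem hi, add_comm]
    exact mul_mem_orderIdeal (hf i (by simp)) (ih fun j hj => hf j (by simp [hj]))

theorem prod_sub_prod_mem_orderIdeal {ι : Type*} (s : Finset ι)
    {f g : ι → MvPowerSeries (Fin 2) k} (hg : ∀ i ∈ s, g i ∈ orderIdeal k 1)
    (hfg : ∀ i ∈ s, f i - g i ∈ orderIdeal k 2) :
    ∏ i ∈ s, f i - ∏ i ∈ s, g i ∈ orderIdeal k (s.card + 1) := by
  classical
  induction s using Finset.induction_on with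
  | empty => simp
  | insert i s hi ih =>
    rw [Finset.prod_insert hi, Finset.prod_insert hi, Finset.card_insert_of_notMem hi]
    have hgi := hg i (by simp)
    have hfgi := hfg i (by simp)
    have hfi : f i ∈ orderIdeal k 1 := by
      have := Ideal.add_mem _ (orderIdeal_antitone one_le_two hfgi) hgi
      rwa [sub_add_cancel] at this
    have h1 := mul_mem_orderIdeal hfi (ih (fun j hj => hg j (by simp [hj]))
      fun j hj => hfg j (by simp [hj]))
    have h2 := mul_mem_orderIdeal hfgi
      (prod_mem_orderIdeal s fun j hj => hg j (by simp [hj]))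
    have h3 := Ideal.add_mem _ (orderIdeal_antitone (m := s.card + 1 + 1) (by omega) h1)
      (orderIdeal_antitone (m := s.card + 1 + 1) (by omega) h2)
    convert h3 using 1
    ring

/-- Each Leibniz term is a product of `Fintype.card n` entries of order at least 1, so changes of
order 2 in the entries leave the form of degree `Fintype.card n` untouched. -/
theorem det_sub_det_mem_orderIdeal {n : Type*} [Fintype n] [DecidableEq n]
    {M M' : Matrix n n (MvPowerSeries (Fin 2) k)} (hM' : ∀ i j, M' i j ∈ orderIdeal k 1)
    (h : ∀ i j, M i j - M' i j ∈ orderIdeal k 2) :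
    M.det - M'.det ∈ orderIdeal k (Fintype.card n + 1) := by
  rw [Matrix.det_apply', Matrix.det_apply', ← Finset.sum_sub_distrib]
  refine Ideal.sum_mem _ fun σ _ => ?_
  rw [← mul_sub]
  refine Ideal.mul_mem_left _ _ ?_
  exact prod_sub_prod_mem_orderIdeal Finset.univ (fun i _ => hM' _ _) fun i _ => h _ _

theorem X_mem_orderIdeal_one (i : Fin 2) : (X i : MvPowerSeries (Fin 2) k) ∈ orderIdeal k 1 :=
  mem_orderIdeal_one.2 (constantCoeff_X i)

theorem sub_C_mem_orderIdeal_one (f : MvPowerSeries (Fin 2) k) :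
    f - C (constantCoeff f) ∈ orderIdeal k 1 :=
  mem_orderIdeal_one.2 (by simp)

variable {O : Subalgebra k (MvPowerSeries (Fin 2) k)} {n : Type*} [Fintype n] [DecidableEq n]

/-- If the determinant of `x P + y Q` has the least possible order, then some specialization of the
linear pencil at the origin is invertible. -/
theorem IsAdmissible.exists_det_ne_zero [Infinite k] (hO : IsAdmissible O) {P Q : Matrix n n O}
    (h0 : (hO.coord 0 • P + hO.coord 1 • Q).det ≠ 0)
    (hm : mult ((hO.coord 0 • P + hO.coord 1 • Q).det : MvPowerSeries (Fin 2) k) =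
      Fintype.card n) :
    ∃ a b c d : k, a * d - b * c = 1 ∧
      (a • P.map (evalZero O) + b • Q.map (evalZero O)).det ≠ 0 := by
  let Z : Matrix n n (MvPolynomial (Fin 2) k) := (MvPolynomial.X 0 : MvPolynomial (Fin 2) k) •
    (P.map (evalZero O)).map MvPolynomial.C + (MvPolynomial.X 1 : MvPolynomial (Fin 2) k) •
    (Q.map (evalZero O)).map MvPolynomial.C
  let F : MvPolynomial (Fin 2) k := Z.det
  -- F agrees with the determinant up to order `Fintype.card n + 1`; if F were zero, the determinant
  -- would have too large an order.
  have hF : F ≠ 0 := by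
    intro hF
    have h1 : ((hO.coord 0 • P + hO.coord 1 • Q).det : MvPowerSeries (Fin 2) k) -
        (F : MvPowerSeries (Fin 2) k) ∈ orderIdeal k (Fintype.card n + 1) := by
      have e1 : ((hO.coord 0 • P + hO.coord 1 • Q).det : MvPowerSeries (Fin 2) k) = _ :=
        RingHom.map_det O.val.toRingHom _
      have e2 := RingHom.map_det (MvPolynomial.coeToMvPowerSeries.ringHom (σ := Fin 2) (R := k)) Z
      rw [MvPolynomial.coeToMvPowerSeries.ringHom_apply] at e2
      rw [e1, e2]
      simp only [Z]
      refine det_sub_det_mem_orderIdeal (fun i j => ?_) fun i j => ?_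
      · simp only [RingHom.mapMatrix_apply, Matrix.map_apply, Matrix.add_apply, Matrix.smul_apply,
          smul_eq_mul, map_add, map_mul, MvPolynomial.coeToMvPowerSeries.ringHom_apply,
          MvPolynomial.coe_X]
        exact Ideal.add_mem _ (Ideal.mul_mem_right _ _ (X_mem_orderIdeal_one 0))
          (Ideal.mul_mem_right _ _ (X_mem_orderIdeal_one 1))
      · have h2 := Ideal.add_mem _ (mul_mem_orderIdeal (X_mem_orderIdeal_one 0)
          (sub_C_mem_orderIdeal_one (P i j : MvPowerSeries (Fin 2) k)))
          (mul_mem_orderIdeal (X_mem_orderIdeal_one 1)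
          (sub_C_mem_orderIdeal_one (Q i j : MvPowerSeries (Fin 2) k)))
        convert h2 using 1
        simp only [RingHom.mapMatrix_apply, Matrix.map_apply, Matrix.add_apply, Matrix.smul_apply,
          smul_eq_mul, map_add, map_mul, MvPolynomial.coeToMvPowerSeries.ringHom_apply,
          MvPolynomial.coe_X, MvPolynomial.coe_C, evalZero_apply]
        change X 0 * (P i j : MvPowerSeries (Fin 2) k) + X 1 * (Q i j : MvPowerSeries (Fin 2) k) -
          _ = _
        ring
    rw [hF, MvPolynomial.coe_zero, sub_zero, mem_orderIdeal,
      ← coe_mult (fun h => h0 (Subtype.ext h)), hm] at h1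
    have : Fintype.card n + 1 ≤ Fintype.card n := by exact_mod_cast h1
    omega
  have heval : ∀ s : Fin 2 → k, MvPolynomial.eval s F =
      (s 0 • P.map (evalZero O) + s 1 • Q.map (evalZero O)).det := by
    intro s
    rw [RingHom.map_det]
    congr 1
    ext i j
    simp [Z]
  have hab : ∃ a b : k, (a ≠ 0 ∨ b ≠ 0) ∧
      (a • P.map (evalZero O) + b • Q.map (evalZero O)).det ≠ 0 := by
    cases isEmpty_or_nonempty n with
    -- The empty determinant is 1 everywhere, even at (0, 0), so a nonzero pair is picked by hand.
    | inl h => exact ⟨1, 0, Or.inl one_ne_zero, by simp⟩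
    | inr h =>
      obtain ⟨s, hs⟩ : ∃ s, MvPolynomial.eval s F ≠ 0 := by
        by_contra hcon
        push Not at hcon
        exact hF (MvPolynomial.funext fun s => by rw [hcon, map_zero])
      rw [heval] at hs
      refine ⟨s 0, s 1, ?_, hs⟩
      by_contra hcon
      push Not at hcon
      rw [hcon.1, hcon.2, zero_smul, zero_smul, add_zero, Matrix.det_zero] at hs
      exact hs rfl
  obtain ⟨a, b, hne, h⟩ := hab
  rcases hne with ha | hb
  · exact ⟨a, b, 0, a⁻¹, by field_simp; ring, h⟩
  · exact ⟨a, b, -b⁻¹, 0, by field_simp; ring, h⟩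

/-- The element `d x - c y` of `O`. -/
def IsAdmissible.linU (hO : IsAdmissible O) (c d : k) : O :=
  algebraMap k O d * hO.coord 0 - algebraMap k O c * hO.coord 1

/-- The element `a y - b x` of `O`. -/
def IsAdmissible.linV (hO : IsAdmissible O) (a b : k) : O :=
  algebraMap k O a * hO.coord 1 - algebraMap k O b * hO.coord 0

theorem IsAdmissible.coord_zero_eq (hO : IsAdmissible O) {a b c d : k}
    (h : a * d - b * c = 1) :
    hO.coord 0 = algebraMap k O a * hO.linU c d + algebraMap k O c * hO.linV a b := by
  have h' := congrArg (algebraMap k O) h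
  rw [map_sub, map_mul, map_mul, map_one] at h'
  rw [linU, linV]
  linear_combination -hO.coord 0 * h'

theorem IsAdmissible.coord_one_eq (hO : IsAdmissible O) {a b c d : k}
    (h : a * d - b * c = 1) :
    hO.coord 1 = algebraMap k O b * hO.linU c d + algebraMap k O d * hO.linV a b := by
  have h' := congrArg (algebraMap k O) h
  rw [map_sub, map_mul, map_mul, map_one] at h'
  rw [linU, linV]
  linear_combination -hO.coord 1 * h'

/-- A maximally generated matrix is equivalent to a block diagonal matrix `u + v Λ`, where `u`, `v`
are linear coordinates and each block of `Λ` has only one eigenvalue at the origin. -/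
theorem IsAdmissible.exists_normalForm [IsAlgClosed k] (hO : IsAdmissible O)
    {n : Type} [Fintype n] [DecidableEq n] {M : Matrix n n O} (h0 : M.map (evalZero O) = 0)
    (hdet : M.det ≠ 0) (hm : mult (M.det : MvPowerSeries (Fin 2) k) = Fintype.card n) :
    ∃ a b c d : k, a * d - b * c = 1 ∧
      ∃ (β : n → k) (N : Matrix n n k) (Λ : Matrix n n O) (A B : (Matrix n n O)ˣ),
        IsNilpotent N ∧ Commute (Matrix.diagonal β) N ∧ (∀ i j, β i ≠ β j → Λ i j = 0) ∧
        Λ.map (evalZero O) = Matrix.diagonal β + N ∧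
        M = A * (hO.linU c d • 1 + hO.linV a b • Λ) * B := by
  have hM : ∀ i j, ∃ g h : O, M i j = hO.coord 0 * g + hO.coord 1 * h := by
    intro i j
    obtain ⟨g, -, h, -, e⟩ := hO.exists_eq_coord_mul_add (n := 0) (f := M i j)
      (mem_orderIdealIn_one.2 (congrFun (congrFun h0 i) j))
    exact ⟨g, h, e⟩
  choose P Q hPQ using hM
  have hM : M = hO.coord 0 • Matrix.of P + hO.coord 1 • Matrix.of Q :=
    Matrix.ext fun i j => hPQ i j
  set P' : Matrix n n O := Matrix.of P
  set Q' : Matrix n n O := Matrix.of Q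
  rw [hM] at hdet hm
  obtain ⟨a, b, c, d, habcd, hab⟩ := hO.exists_det_ne_zero hdet hm
  refine ⟨a, b, c, d, habcd, ?_⟩
  have hG : IsUnit (algebraMap k O a • P' + algebraMap k O b • Q') := by
    refine hO.isUnit_of_isUnit_map_evalZero ?_
    have h1 : ∀ t : k, evalZero O (algebraMap k O t) = t :=
      RingHom.congr_fun (evalZero_comp_algebraMap (O := O))
    have h2 : (algebraMap k O a • P' + algebraMap k O b • Q').map (evalZero O) =
        a • P'.map (evalZero O) + b • Q'.map (evalZero O) := by
      refine Matrix.ext fun i j => ?_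
      simp only [Matrix.map_apply, Matrix.add_apply, Matrix.smul_apply, smul_eq_mul, map_add,
        map_mul, h1]
    rw [h2, Matrix.isUnit_iff_isUnit_det]
    exact isUnit_iff_ne_zero.2 hab
  obtain ⟨G, hG⟩ := hG
  set K := algebraMap k O c • P' + algebraMap k O d • Q' with hK
  -- Substituting x = a u + c v and y = b u + d v gives M = u (aP + bQ) + v (cP + dQ) = uG + vK.
  have hM2 : M = G * (hO.linU c d • 1 + hO.linV a b • ((↑G⁻¹ : Matrix n n O) * K)) := by
    rw [mul_add, Matrix.mul_smul, Matrix.mul_smul, mul_one, Units.mul_inv_cancel_left, hG, hK, hM,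
      hO.coord_zero_eq habcd, hO.coord_one_eq habcd]
    refine Matrix.ext fun i j => ?_
    simp only [Matrix.add_apply, Matrix.smul_apply, smul_eq_mul]
    ring
  set T : Matrix n n O := (↑G⁻¹ : Matrix n n O) * K
  obtain ⟨S, β, N, hN, hβN, hS⟩ := exists_conj_diagonal_add_nilpotent (T.map (evalZero O))
  let SO : (Matrix n n O)ˣ := Units.map (algebraMap k O).mapMatrix.toMonoidHom S
  have hSO : ((SO : Matrix n n O)).map (evalZero O) = S := map_algebraMap_map_evalZero _
  have hSO' : ((↑SO⁻¹ : Matrix n n O)).map (evalZero O) = (↑S⁻¹ : Matrix n n k) :=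
    map_algebraMap_map_evalZero _
  have hconj : ((↑SO⁻¹ : Matrix n n O) * T * SO).map (evalZero O) = Matrix.diagonal β + N := by
    rw [Matrix.map_mul, Matrix.map_mul, hSO, hSO', mul_assoc, hS, Units.inv_mul_cancel_left]
  obtain ⟨U, Λ, hΛ, hΛ0, hU⟩ := hO.exists_block_conj hN hβN hconj
  refine ⟨β, N, Λ, G * SO * U, U⁻¹ * SO⁻¹, hN, hβN, hΛ, hΛ0, ?_⟩
  have hT : T = SO * U * Λ * (↑U⁻¹ : Matrix n n O) * (↑SO⁻¹ : Matrix n n O) := by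
    rw [mul_assoc (SO : Matrix n n O), ← hU]
    simp only [mul_assoc, Units.mul_inv_cancel_left, Units.mul_inv, mul_one]
  rw [hM2, hT]
  simp only [Units.val_mul, mul_add, add_mul, Matrix.mul_smul, Matrix.smul_mul, mul_assoc, mul_one,
    Units.mul_inv_cancel_left, Units.mul_inv]

/-! ### The determinant of a block -/

/-- The determinant is the characteristic polynomial of the nilpotent matrix -tN, a pure power of
the variable over a domain, evaluated at s. -/
theorem det_smul_one_add_smul_of_isNilpotent {A : Type*} [CommRing A] [IsDomain A]
    {N : Matrix n n A} (hN : IsNilpotent N) (s t : A) :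
    (s • (1 : Matrix n n A) + t • N).det = s ^ Fintype.card n := by
  have h1 : IsNilpotent (-(t • N)) := by
    obtain ⟨m, hm⟩ := hN
    exact IsNilpotent.neg ⟨m, by rw [smul_pow, hm, smul_zero]⟩
  have h2 := sub_eq_zero.1 (Matrix.isNilpotent_charpoly_sub_pow_of_isNilpotent h1).eq_zero
  have h3 := Matrix.eval_charpoly (-(t • N)) s
  rw [h2, sub_neg_eq_add, Polynomial.eval_pow, Polynomial.eval_X] at h3
  rw [h3, Matrix.smul_one_eq_diagonal, Matrix.scalar_apply]

/-- The lowest order form of the determinant of a block `u + v Λ` with one eigenvalue. -/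
theorem IsAdmissible.det_block_sub_mem (hO : IsAdmissible O) {a b c d μ : k} {N : Matrix n n k}
    (hN : IsNilpotent N) {Λ : Matrix n n O}
    (hΛ : Λ.map (evalZero O) = Matrix.diagonal (fun _ => μ) + N) :
    ((hO.linU c d • (1 : Matrix n n O) + hO.linV a b • Λ).det : MvPowerSeries (Fin 2) k) -
      ((pencilForm a b c d μ ^ Fintype.card n : MvPolynomial (Fin 2) k) : MvPowerSeries (Fin 2) k) ∈
      orderIdeal k (Fintype.card n + 1) := by
  let V : MvPolynomial (Fin 2) k :=
    MvPolynomial.C a * MvPolynomial.X 1 + MvPolynomial.C (-b) * MvPolynomial.X 0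
  let U : MvPolynomial (Fin 2) k :=
    MvPolynomial.C d * MvPolynomial.X 0 + MvPolynomial.C (-c) * MvPolynomial.X 1
  have hUV : pencilForm a b c d μ = U + MvPolynomial.C μ * V := by
    simp only [pencilForm, map_sub, map_mul, map_neg, U, V]
    ring
  have hN' : IsNilpotent (N.map (MvPolynomial.C (σ := Fin 2))) :=
    hN.map (MvPolynomial.C (σ := Fin 2)).mapMatrix
  -- The power of u + μv is itself the determinant of (u + μv)·1 + vN, the linear part of the block,
  -- so entrywise comparison modulo order 2 suffices.
  rw [← det_smul_one_add_smul_of_isNilpotent hN' _ V]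
  have e1 : ((hO.linU c d • (1 : Matrix n n O) + hO.linV a b • Λ).det :
    MvPowerSeries (Fin 2) k) = _ := RingHom.map_det O.val.toRingHom _
  have e2 := RingHom.map_det (MvPolynomial.coeToMvPowerSeries.ringHom (σ := Fin 2) (R := k))
    (pencilForm a b c d μ • (1 : Matrix n n (MvPolynomial (Fin 2) k)) +
      V • N.map (MvPolynomial.C (σ := Fin 2)))
  rw [MvPolynomial.coeToMvPowerSeries.ringHom_apply] at e2
  rw [e1, e2]
  have hVm : (V : MvPowerSeries (Fin 2) k) ∈ orderIdeal k 1 := mem_orderIdeal_one.2 (by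
    simp only [V, MvPolynomial.coe_add, MvPolynomial.coe_mul, MvPolynomial.coe_X, map_add, map_mul,
      constantCoeff_X, mul_zero, add_zero])
  have hUm : (U : MvPowerSeries (Fin 2) k) ∈ orderIdeal k 1 := mem_orderIdeal_one.2 (by
    simp only [U, MvPolynomial.coe_add, MvPolynomial.coe_mul, MvPolynomial.coe_X, map_add, map_mul,
      constantCoeff_X, mul_zero, add_zero])
  have hU : ((hO.linU c d : O) : MvPowerSeries (Fin 2) k) = U := by
    change C d * X 0 - C c * X 1 = _
    simp only [U, MvPolynomial.coe_add, MvPolynomial.coe_mul, MvPolynomial.coe_C,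
      MvPolynomial.coe_X]
    rw [map_neg]
    ring
  have hV : ((hO.linV a b : O) : MvPowerSeries (Fin 2) k) = V := by
    change C a * X 1 - C b * X 0 = _
    simp only [V, MvPolynomial.coe_add, MvPolynomial.coe_mul, MvPolynomial.coe_C,
      MvPolynomial.coe_X]
    rw [map_neg]
    ring
  refine det_sub_det_mem_orderIdeal (fun i j => ?_) fun i j => ?_
  · simp only [RingHom.mapMatrix_apply, Matrix.map_apply, Matrix.add_apply, Matrix.smul_apply,
      smul_eq_mul, map_add, map_mul, MvPolynomial.coeToMvPowerSeries.ringHom_apply, hUV]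
    exact Ideal.add_mem _ (Ideal.mul_mem_right _ _ (Ideal.add_mem _ hUm
      (Ideal.mul_mem_left _ _ hVm))) (Ideal.mul_mem_right _ _ hVm)
  · have h1 := mul_mem_orderIdeal hVm (sub_C_mem_orderIdeal_one (Λ i j : MvPowerSeries (Fin 2) k))
    have h2 : constantCoeff (Λ i j : MvPowerSeries (Fin 2) k) =
        (Matrix.diagonal (fun _ => μ) + N : Matrix n n k) i j := by
      rw [← hΛ]; rfl
    rw [h2] at h1
    convert h1 using 1
    simp only [RingHom.mapMatrix_apply, Matrix.map_apply, Matrix.add_apply, Matrix.smul_apply,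
      smul_eq_mul, map_add, map_mul, MvPolynomial.coeToMvPowerSeries.ringHom_apply, hUV,
      MvPolynomial.coe_C]
    change ((hO.linU c d : O) : MvPowerSeries (Fin 2) k) *
        (((1 : Matrix n n O) i j : O) : MvPowerSeries (Fin 2) k) +
      ((hO.linV a b : O) : MvPowerSeries (Fin 2) k) * (Λ i j : MvPowerSeries (Fin 2) k) - _ = _
    rw [hU, hV, Matrix.one_apply, Matrix.one_apply, Matrix.diagonal_apply]
    split_ifs
    · simp only [OneMemClass.coe_one, MvPolynomial.coe_one]
      ring
    · simp only [ZeroMemClass.coe_zero, MvPolynomial.coe_zero, map_zero]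
      ring

end NormalForm

/-! ### Splitting along the eigenvalues, and uniqueness of the components -/

section Blocks

variable {k : Type*} [Field k] {O : Subalgebra k (MvPowerSeries (Fin 2) k)}

/-- The diagonal block of a matrix that is given by a fibre of a map on the indices. -/
abbrev fiberBlock {A n ι : Type*} (cls : n → ι) (M : Matrix n n A) (i : ι) :
    Matrix {j // cls j = i} {j // cls j = i} A :=
  M.submatrix Subtype.val Subtype.val

theorem reindex_eq_blockDiagonal' {A n ι : Type*} [Zero A] [DecidableEq ι] (cls : n → ι)
    {M : Matrix n n A} (hM : ∀ i j, cls i ≠ cls j → M i j = 0) :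
    Matrix.reindex (Equiv.sigmaFiberEquiv cls).symm (Equiv.sigmaFiberEquiv cls).symm M =
      Matrix.blockDiagonal' (fiberBlock cls M) := by
  ext ⟨i, x, rfl⟩ ⟨j, y, rfl⟩
  rw [Matrix.reindex_apply, Matrix.submatrix_apply, Matrix.blockDiagonal'_apply]
  simp only [Equiv.symm_symm, Equiv.sigmaFiberEquiv_apply]
  split_ifs with h
  · have key : ∀ (i : ι) (h : cls y = i) (x : {j // cls j = i}), M x.1 y =
        fiberBlock cls M i x (cast (congrArg (fun i => {j // cls j = i}) h) ⟨y, rfl⟩) := by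
      rintro _ rfl x; rfl
    exact key _ h.symm ⟨x, rfl⟩
  · exact hM x y h

theorem fiberBlock_mul {A n ι : Type*} [CommRing A] [Fintype n] [DecidableEq ι] (cls : n → ι)
    {M M' : Matrix n n A} (hM : ∀ i j, cls i ≠ cls j → M i j = 0) (i : ι) :
    fiberBlock cls (M * M') i = fiberBlock cls M i * fiberBlock cls M' i := by
  ext x y
  change (M * M') x.1 y.1 = _
  rw [Matrix.mul_apply, Matrix.mul_apply]
  simp only [Matrix.submatrix_apply]
  rw [← Finset.sum_subtype (Finset.univ.filter fun t => cls t = i) (by simp)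
    fun t => M x t * M' t y]
  refine (Finset.sum_subset (Finset.subset_univ _) fun t _ ht => ?_).symm
  rw [hM, zero_mul]
  intro h
  exact ht (by simp [← h, x.2])

theorem isNilpotent_fiberBlock {A n ι : Type*} [CommRing A] [Fintype n] [DecidableEq n]
    [DecidableEq ι] (cls : n → ι) {N : Matrix n n A} (hN : ∀ i j, cls i ≠ cls j → N i j = 0)
    (hnil : IsNilpotent N) (i : ι) : IsNilpotent (fiberBlock cls N i) := by
  have hpow : ∀ m : ℕ, fiberBlock cls (N ^ m) i = fiberBlock cls N i ^ m := by
    intro m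
    induction m with
    | zero =>
      rw [pow_zero, pow_zero]
      exact Matrix.submatrix_one _ Subtype.val_injective
    | succ m ih => rw [pow_succ', pow_succ', fiberBlock_mul cls hN, ih]
  obtain ⟨m, hm⟩ := hnil
  exact ⟨m, by rw [← hpow, hm]; rfl⟩

/-- A maximally generated matrix is equivalent to a block diagonal matrix whose blocks have powers
of distinct linear forms as lowest order forms of their determinants. -/
theorem IsAdmissible.exists_blocks [IsAlgClosed k] (hO : IsAdmissible O)
    {n : Type} [Fintype n] [DecidableEq n] {M : Matrix n n O} (h0 : M.map (evalZero O) = 0)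
    (hdet : M.det ≠ 0) (hm : mult (M.det : MvPowerSeries (Fin 2) k) = Fintype.card n) :
    ∃ a b c d : k, a * d - b * c = 1 ∧ ∃ β : n → k,
      ∀ {r : ℕ} (cls : n → Fin r) (μ : Fin r → k), Function.Injective μ → (∀ j, μ (cls j) = β j) →
        ∃ Bl : ∀ i, Matrix {j // cls j = i} {j // cls j = i} O,
          LocallyEquivalent M (Matrix.blockDiagonal' Bl) ∧
          Associated M.det (∏ i, (Bl i).det) ∧
          ∀ i, (Bl i).map (evalZero O) = 0 ∧
            mult ((Bl i).det : MvPowerSeries (Fin 2) k) = Fintype.card {j // cls j = i} ∧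
            initialForm ((Bl i).det : MvPowerSeries (Fin 2) k) =
              pencilForm a b c d (μ i) ^ Fintype.card {j // cls j = i} := by
  obtain ⟨a, b, c, d, habcd, β, N, Λ, A, B, hN, hβN, hΛ, hΛ0, hM⟩ :=
    hO.exists_normalForm h0 hdet hm
  refine ⟨a, b, c, d, habcd, β, fun {r} cls μ hinj hμ => ?_⟩
  have hcls : ∀ i j, cls i ≠ cls j → β i ≠ β j := by
    intro i j hij h
    rw [← hμ, ← hμ] at h
    exact hij (hinj h)
  set L := hO.linU c d • 1 + hO.linV a b • Λ with hL
  have hLoff : ∀ i j, cls i ≠ cls j → L i j = 0 := by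
    intro i j hij
    have hne : i ≠ j := fun h => hij (h ▸ rfl)
    simp [hL, hΛ i j (hcls i j hij), Matrix.one_apply_ne hne]
  have hdetL : L.det = ∏ i, (fiberBlock cls L i).det :=
    Matrix.BlockTriangular.det_fintype (b := cls) fun i j hij => hLoff i j hij.ne'
  have hlin : evalZero O (hO.linU c d) = 0 ∧ evalZero O (hO.linV a b) = 0 := by
    have hx : ∀ i, evalZero O (hO.coord i) = 0 := fun i => constantCoeff_X i
    simp [IsAdmissible.linU, IsAdmissible.linV, hx]
  have hL0 : L.map (evalZero O) = 0 := by
    refine Matrix.ext fun i j => ?_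
    simp [hL, hlin.1, hlin.2]
  have hblock : ∀ i, fiberBlock cls L i = hO.linU c d • (1 : Matrix {j // cls j = i} _ O) +
      hO.linV a b • fiberBlock cls Λ i := by
    intro i
    rw [hL, ← Matrix.submatrix_one (α := O) (Subtype.val : {j // cls j = i} → n)
      Subtype.val_injective]
    rfl
  refine ⟨fiberBlock cls L, ?_, ?_, fun i => ⟨?_, ?_⟩⟩
  · let e := (Equiv.sigmaFiberEquiv cls).symm
    refine ⟨e, Units.map (Matrix.reindexRingEquiv O e).toRingHom.toMonoidHom A,
      Units.map (Matrix.reindexRingEquiv O e).toRingHom.toMonoidHom B, ?_⟩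
    rw [← reindex_eq_blockDiagonal' cls hLoff, hM, ← Matrix.coe_reindexRingEquiv, map_mul, map_mul]
    rfl
  · rw [← hdetL, hM, Matrix.det_mul, Matrix.det_mul]
    have hA := (Matrix.isUnit_iff_isUnit_det _).1 A.isUnit
    have hB := (Matrix.isUnit_iff_isUnit_det _).1 B.isUnit
    exact (associated_mul_unit_left _ _ hB).trans (associated_unit_mul_left _ _ hA)
  · refine Matrix.ext fun x y => ?_
    exact congrFun (congrFun hL0 x.1) y.1
  · refine mult_and_initialForm_eq ?_ (pow_ne_zero _ (pencilForm_ne_zero habcd _)) ?_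
    · simpa using (pencilForm_isHomogeneous a b c d (μ i)).pow (Fintype.card {j // cls j = i})
    · rw [hblock]
      have hNoff : ∀ i j, cls i ≠ cls j → N i j = 0 := fun i j hij =>
        apply_eq_zero_of_commute_diagonal hβN (hcls i j hij)
      refine hO.det_block_sub_mem (isNilpotent_fiberBlock cls hNoff hN i) ?_
      refine Matrix.ext fun x y => ?_
      have h1 := congrFun (congrFun hΛ0 x.1) y.1
      refine h1.trans ?_
      rw [Matrix.add_apply, Matrix.add_apply, Matrix.diagonal_apply, Matrix.diagonal_apply, ← hμ,
        x.2]
      simp only [Subtype.ext_iff]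
      rfl

/-! ### Uniqueness of tangential components -/

/-- The linear form `u + μ v` as an element of `O`. -/
def IsAdmissible.lin (hO : IsAdmissible O) (a b c d μ : k) : O :=
  hO.linU c d + algebraMap k O μ * hO.linV a b

theorem IsAdmissible.coe_lin (hO : IsAdmissible O) (a b c d μ : k) :
    (hO.lin a b c d μ : MvPowerSeries (Fin 2) k) = pencilForm a b c d μ := by
  change (C d * X 0 - C c * X 1) + C μ * (C a * X 1 - C b * X 0) = _
  rw [pencilForm, MvPolynomial.coe_add, MvPolynomial.coe_mul, MvPolynomial.coe_mul,
    MvPolynomial.coe_C, MvPolynomial.coe_C, MvPolynomial.coe_X, MvPolynomial.coe_X, map_sub,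
    map_sub, map_mul, map_mul]
  ring

/-- The difference of the two forms is (μ - ν) v, which yields v, then u, then both coordinates. -/
theorem IsAdmissible.span_lin_sup (hO : IsAdmissible O) {a b c d μ ν : k}
    (h : a * d - b * c = 1) (hne : μ ≠ ν) :
    Ideal.span {hO.lin a b c d μ} ⊔ Ideal.span {hO.lin a b c d ν} =
      Ideal.span {hO.coord 0, hO.coord 1} := by
  refine le_antisymm ?_ ?_
  · have hx : hO.coord 0 ∈ Ideal.span {hO.coord 0, hO.coord 1} := Ideal.subset_span (by simp)
    have hy : hO.coord 1 ∈ Ideal.span {hO.coord 0, hO.coord 1} := Ideal.subset_span (by simp)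
    have hlin : ∀ ρ, hO.lin a b c d ρ ∈ Ideal.span {hO.coord 0, hO.coord 1} := fun ρ =>
      Ideal.add_mem _ (Ideal.sub_mem _ (Ideal.mul_mem_left _ _ hx) (Ideal.mul_mem_left _ _ hy))
        (Ideal.mul_mem_left _ _ (Ideal.sub_mem _ (Ideal.mul_mem_left _ _ hy)
          (Ideal.mul_mem_left _ _ hx)))
    exact sup_le ((Ideal.span_singleton_le_iff_mem _).2 (hlin μ))
      ((Ideal.span_singleton_le_iff_mem _).2 (hlin ν))
  · set I := Ideal.span {hO.lin a b c d μ} ⊔ Ideal.span {hO.lin a b c d ν}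
    have h1 : hO.lin a b c d μ ∈ I := Ideal.mem_sup_left (Ideal.mem_span_singleton_self _)
    have h2 : hO.lin a b c d ν ∈ I := Ideal.mem_sup_right (Ideal.mem_span_singleton_self _)
    have hv : hO.linV a b ∈ I := by
      have h3 := I.mul_mem_left (algebraMap k O (μ - ν)⁻¹) (I.sub_mem h1 h2)
      have h4 : algebraMap k O (μ - ν)⁻¹ * algebraMap k O (μ - ν) = 1 := by
        rw [← map_mul, inv_mul_cancel₀ (sub_ne_zero.2 hne), map_one]
      convert h3 using 1
      rw [map_sub] at h4
      rw [lin, lin]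
      linear_combination -hO.linV a b * h4
    have hu : hO.linU c d ∈ I := by
      have h3 := I.sub_mem h1 (I.mul_mem_left (algebraMap k O μ) hv)
      rwa [lin, add_sub_cancel_right] at h3
    rw [Ideal.span_le]
    rintro z (rfl | rfl)
    · rw [hO.coord_zero_eq h]
      exact I.add_mem (I.mul_mem_left _ hu) (I.mul_mem_left _ hv)
    · rw [hO.coord_one_eq h]
      exact I.add_mem (I.mul_mem_left _ hu) (I.mul_mem_left _ hv)

/-- Knowledge of the initial form becomes the ideal membership needed by
`IsAdmissible.dvd_of_dvd_mul_right`: t⁻¹ f differs from the power of the linear form by order m + 1.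
-/
theorem IsAdmissible.lin_pow_mem (hO : IsAdmissible O) {a b c d μ t : k} {f : O} {m : ℕ}
    (hm : mult (f : MvPowerSeries (Fin 2) k) = m) (ht : t ≠ 0)
    (hf : initialForm (f : MvPowerSeries (Fin 2) k) =
      MvPolynomial.C t * pencilForm a b c d μ ^ m) :
    hO.lin a b c d μ ^ m ∈
      Ideal.span {f} ⊔ Ideal.span {hO.coord 0, hO.coord 1} ^ (m + 1) := by
  have h1 : f - algebraMap k O t * hO.lin a b c d μ ^ m ∈ orderIdealIn O (m + 1) := by
    have h2 := sub_initialForm_mem (f : MvPowerSeries (Fin 2) k)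
    rw [hf, hm, MvPolynomial.coe_mul, MvPolynomial.coe_pow, ← hO.coe_lin, MvPolynomial.coe_C] at h2
    exact h2
  have h2 := hO.orderIdealIn_le_pow _ h1
  have h3 : algebraMap k O t⁻¹ * algebraMap k O t = 1 := by
    rw [← map_mul, inv_mul_cancel₀ ht, map_one]
  refine Submodule.mem_sup.2 ⟨algebraMap k O t⁻¹ * f,
    Ideal.mul_mem_left _ _ (Ideal.mem_span_singleton_self f), _,
    Ideal.mul_mem_left _ (-algebraMap k O t⁻¹) h2, ?_⟩
  linear_combination hO.lin a b c d μ ^ m * h3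

/-- Two factorizations into factors with the same system of distinct tangents agree up to units. -/
theorem IsAdmissible.associated_of_associated_prod (hO : IsAdmissible O) {a b c d : k}
    (h : a * d - b * c = 1) {ι : Type*} [Fintype ι] {μ : ι → k} (hμ : Function.Injective μ)
    {f g : ι → O} (hfg : Associated (∏ i, f i) (∏ i, g i)) (hf0 : ∀ i, f i ≠ 0)
    (hg0 : ∀ i, g i ≠ 0)
    (hf : ∀ i, ∃ t : k, t ≠ 0 ∧ initialForm (f i : MvPowerSeries (Fin 2) k) =
      MvPolynomial.C t * pencilForm a b c d (μ i) ^ mult (f i : MvPowerSeries (Fin 2) k))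
    (hg : ∀ i, ∃ t : k, t ≠ 0 ∧ initialForm (g i : MvPowerSeries (Fin 2) k) =
      MvPolynomial.C t * pencilForm a b c d (μ i) ^ mult (g i : MvPowerSeries (Fin 2) k))
    (i : ι) : Associated (f i) (g i) := by
  classical
  have key : ∀ {f g : ι → O} (_ : (∏ i, f i) ∣ ∏ i, g i) (_ : ∀ i, f i ≠ 0)
      (_ : ∀ i, ∃ t : k, t ≠ 0 ∧ initialForm (f i : MvPowerSeries (Fin 2) k) =
        MvPolynomial.C t * pencilForm a b c d (μ i) ^ mult (f i : MvPowerSeries (Fin 2) k))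
      (_ : ∀ i, ∃ t : k, t ≠ 0 ∧ initialForm (g i : MvPowerSeries (Fin 2) k) =
        MvPolynomial.C t * pencilForm a b c d (μ i) ^ mult (g i : MvPowerSeries (Fin 2) k)),
      f i ∣ g i := by
    intro f g hfg hf0 hf hg
    -- Each g j with j ≠ i has a different tangent, hence forms a regular sequence with f i and can
    -- be cancelled.
    have strip : ∀ s : Finset ι, i ∉ s → ∀ p : O, f i ∣ p * ∏ j ∈ s, g j → f i ∣ p := by
      intro s
      induction s using Finset.induction_on with
      | empty => intro _ p hp; simpa using hp
      | insert j s hj ih =>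
        intro hi p hp
        rw [Finset.prod_insert hj, ← mul_assoc] at hp
        have hp' := ih (fun h => hi (by simp [h])) _ hp
        have hne : μ i ≠ μ j := fun h => hi (by simp [hμ h])
        obtain ⟨t, ht, hft⟩ := hf i
        obtain ⟨s, hs, hgs⟩ := hg j
        exact hO.dvd_of_dvd_mul_right (hO.span_lin_sup h hne) (hf0 i)
          (hO.lin_pow_mem rfl ht hft) (hO.lin_pow_mem rfl hs hgs) hp'
    refine strip (Finset.univ.erase i) (by simp) _ ?_
    rw [Finset.mul_prod_erase _ _ (Finset.mem_univ i)]
    exact (Finset.dvd_prod_of_mem _ (Finset.mem_univ i)).trans hfg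
  exact associated_of_dvd_dvd (key hfg.dvd hf0 hf hg) (key hfg.symm.dvd hg0 hg hf)

end Blocks

/-! ### Tangential decompositions of maximally generated matrices -/

section Decomposition

theorem LocallyEquivalent.reindex_right {k : Type*} [Field k]
    {O : Subalgebra k (MvPowerSeries (Fin 2) k)} {m n n' : Type*} [Fintype m] [DecidableEq m]
    [Fintype n] [DecidableEq n] [Fintype n'] [DecidableEq n'] {M : Matrix m m O}
    {N : Matrix n n O} (h : LocallyEquivalent M N) (e : n ≃ n') :
    LocallyEquivalent M (Matrix.reindex e e N) := by
  obtain ⟨e₀, A, B, h⟩ := h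
  refine ⟨e₀.trans e, Units.map (Matrix.reindexRingEquiv O e).toRingHom.toMonoidHom A,
    Units.map (Matrix.reindexRingEquiv O e).toRingHom.toMonoidHom B, ?_⟩
  have h1 := congrArg (Matrix.reindexRingEquiv O e) h
  rw [map_mul, map_mul] at h1
  exact h1

theorem reindex_sigmaCongrRight_blockDiagonal' {A ι : Type*} [Zero A] [DecidableEq ι]
    {m n : ι → Type*} (e : ∀ i, m i ≃ n i) (N : ∀ i, Matrix (m i) (m i) A) :
    Matrix.reindex (Equiv.sigmaCongrRight e) (Equiv.sigmaCongrRight e)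
      (Matrix.blockDiagonal' N) =
      Matrix.blockDiagonal' fun i => Matrix.reindex (e i) (e i) (N i) := by
  ext ⟨i, x⟩ ⟨j, y⟩
  by_cases h : i = j
  · subst h
    change Matrix.blockDiagonal' N ⟨i, (e i).symm x⟩ ⟨i, (e i).symm y⟩ = _
    rw [Matrix.blockDiagonal'_apply_eq, Matrix.blockDiagonal'_apply_eq]
    rfl
  · change Matrix.blockDiagonal' N ⟨i, (e i).symm x⟩ ⟨j, (e j).symm y⟩ = _
    rw [Matrix.blockDiagonal'_apply_ne _ _ _ h, Matrix.blockDiagonal'_apply_ne _ _ _ h]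

variable {k : Type*} [Field k] {O : Subalgebra k (MvPowerSeries (Fin 2) k)}

theorem corankAtZero_eq_card {n : Type*} [Fintype n] [DecidableEq n] {M : Matrix n n O}
    (h : valueAtZero M = 0) : corankAtZero M = Fintype.card n := by
  rw [corankAtZero, h, Matrix.rank_zero, Nat.sub_zero]

theorem tangentCone_of_initialForm_eq_pow {a b c d : k} (h : a * d - b * c = 1) {μ t : k} {m : ℕ}
    (hm : m ≠ 0) (ht : t ≠ 0) {f : MvPowerSeries (Fin 2) k}
    (hf : initialForm f = MvPolynomial.C t * pencilForm a b c d μ ^ m) :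
    tangentCone f = pencilLine a b c d μ := by
  ext v
  rw [SetLike.mem_coe, mem_pencilLine h, tangentCone, Set.mem_ofPred_eq, hf]
  simp [ht, hm]

/-- The main theorem for admissible rings of power series. -/
theorem IsAdmissible.tangential_decomposition [IsAlgClosed k] (hO : IsAdmissible O) {p : ℕ}
    {M : Matrix (Fin p) (Fin p) O} {f : O} (hM : IsDetRep M f) (hmax : IsMaximallyGenerated M) :
    Nonempty (TangentialDecomposition f) ∧
    ∀ D : TangentialDecomposition f,
      ∃ N : ∀ i : Fin D.r, Matrix (Fin (mult (D.comp i : MvPowerSeries (Fin 2) k)))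
          (Fin (mult (D.comp i : MvPowerSeries (Fin 2) k))) O,
        LocallyEquivalent M (Matrix.blockDiagonal' N) ∧
        ∀ i, IsDetRep (N i) (D.comp i) ∧ IsMaximallyGenerated (N i) := by
  classical
  have hm : mult (M.det : MvPowerSeries (Fin 2) k) = Fintype.card (Fin p) := by
    rw [← hmax, corankAtZero_eq_card hM.vanishes]
  -- The eigenvalues β are fixed here, while the labelling of the blocks stays free: it must later
  -- follow the order of the lines in a given decomposition.
  obtain ⟨a, b, c, d, habcd, β, hβ⟩ := hO.exists_blocks hM.vanishes hM.det_ne_zero hm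
  have hf0 : f ≠ 0 := hM.associated.ne_zero_iff.1 hM.det_ne_zero
  -- the common properties of the block decompositions
  have hblocks : ∀ {r : ℕ} (μ : Fin r → k), Function.Injective μ → Set.range μ = Set.range β →
      ∃ (cls : Fin p → Fin r) (Bl : ∀ i, Matrix {j // cls j = i} {j // cls j = i} O),
        LocallyEquivalent M (Matrix.blockDiagonal' Bl) ∧ Associated f (∏ i, (Bl i).det) ∧
        ∀ i, (Bl i).map (evalZero O) = 0 ∧ (Bl i).det ≠ 0 ∧
          mult ((Bl i).det : MvPowerSeries (Fin 2) k) = Fintype.card {j // cls j = i} ∧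
          initialForm ((Bl i).det : MvPowerSeries (Fin 2) k) =
            MvPolynomial.C 1 * pencilForm a b c d (μ i) ^
              mult ((Bl i).det : MvPowerSeries (Fin 2) k) ∧
          tangentCone ((Bl i).det : MvPowerSeries (Fin 2) k) = pencilLine a b c d (μ i) := by
    intro r μ hinj hrange
    have hex : ∀ j, ∃ i, μ i = β j := fun j => by
      rw [← Set.mem_range, hrange]; exact ⟨j, rfl⟩
    choose cls hcls using hex
    obtain ⟨Bl, hequiv, hassoc, hBl⟩ := hβ cls μ hinj hcls
    have hassoc' : Associated f (∏ i, (Bl i).det) := hM.associated.symm.trans hassoc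
    have hne : ∀ i, (Bl i).det ≠ 0 := fun i =>
      Finset.prod_ne_zero_iff.1 (hassoc'.ne_zero_iff.1 hf0) i (Finset.mem_univ i)
    refine ⟨cls, Bl, hequiv, hassoc', fun i => ?_⟩
    obtain ⟨h1, h2, h3⟩ := hBl i
    have h4 : initialForm ((Bl i).det : MvPowerSeries (Fin 2) k) =
        MvPolynomial.C 1 * pencilForm a b c d (μ i) ^
          mult ((Bl i).det : MvPowerSeries (Fin 2) k) := by
      rw [MvPolynomial.C_1, one_mul, h3, h2]
    refine ⟨h1, hne i, h2, h4, tangentCone_of_initialForm_eq_pow habcd ?_ one_ne_zero h4⟩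
    -- Each label is an actual eigenvalue, so no block is empty; an empty block would have an empty
    -- tangent cone.
    obtain ⟨j, hj⟩ : μ i ∈ Set.range β := hrange ▸ ⟨i, rfl⟩
    have : Nonempty {j // cls j = i} := ⟨⟨j, hinj (by rw [hcls, hj])⟩⟩
    rw [h2]
    exact Fintype.card_ne_zero
  have hlines : ∀ {r : ℕ} (μ : Fin r → k), Function.Injective μ → Set.range μ = Set.range β →
      tangentLines (f : MvPowerSeries (Fin 2) k) =
        Set.range fun i => pencilLine a b c d (μ i) := by
    intro r μ hinj hrange
    obtain ⟨cls, Bl, -, hassoc, hBl⟩ := hblocks μ hinj hrange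
    refine tangentLines_eq_range (fun i => finrank_pencilLine habcd _) ?_
    rw [tangentCone_eq_of_associated hassoc hf0]
    have e : ((∏ i, (Bl i).det : O) : MvPowerSeries (Fin 2) k) =
        ∏ i, ((Bl i).det : MvPowerSeries (Fin 2) k) := map_prod O.val _ _
    rw [e, tangentCone_prod _ fun i _ => by simpa using (hBl i).2.1]
    simp [(hBl _).2.2.2.2]
  have hexμ : ∃ (r : ℕ) (μ : Fin r → k), Function.Injective μ ∧ Set.range μ = Set.range β := by
    let e := (Finite.equivFin (Set.range β)).symm
    refine ⟨Nat.card (Set.range β), fun i => e i, Subtype.val_injective.comp e.injective, ?_⟩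
    rw [← Function.comp_def, e.surjective.range_comp, Subtype.range_coe]
  obtain ⟨r₀, μ₀, hinj₀, hrange₀⟩ := hexμ
  have hlines₀ := hlines μ₀ hinj₀ hrange₀
  refine ⟨?_, fun D => ?_⟩
  · obtain ⟨cls, Bl, -, hassoc, hBl⟩ := hblocks μ₀ hinj₀ hrange₀
    let line : Fin r₀ → tangentLines (f : MvPowerSeries (Fin 2) k) := fun i =>
      ⟨pencilLine a b c d (μ₀ i), hlines₀ ▸ ⟨i, rfl⟩⟩
    have hline : Function.Bijective line := by
      refine ⟨fun i j hij => hinj₀ (eq_of_pencilLine_le habcd (congrArg Subtype.val hij).le), ?_⟩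
      rintro ⟨K, hK⟩
      have hK' := hK
      rw [hlines₀] at hK'
      obtain ⟨i, hi⟩ := hK'
      exact ⟨i, Subtype.ext hi⟩
    exact ⟨⟨r₀, Equiv.ofBijective line hline, fun i => (Bl i).det, hassoc,
      fun i => (hBl i).2.2.2.2⟩⟩
  · have hexD : ∀ i, ∃ j, pencilLine a b c d (μ₀ j) = (D.line i : Submodule k (Fin 2 → k)) := by
      exact fun i => hlines₀.subset (D.line i).2
    -- The map σ matches the lines of D with the reference list of eigenvalues; it is a bijection,
    -- so μ₀ ∘ σ relabels the blocks in the order of D.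
    choose σ hσ using hexD
    have hinj : Function.Injective (μ₀ ∘ σ) := by
      intro i j hij
      refine D.line.injective (Subtype.ext ?_)
      rw [← hσ, ← hσ, hinj₀ hij]
    have hrange : Set.range (μ₀ ∘ σ) = Set.range β := by
      rw [← hrange₀]
      refine Function.Surjective.range_comp (fun j => ?_) μ₀
      have hj : pencilLine a b c d (μ₀ j) ∈ tangentLines (f : MvPowerSeries (Fin 2) k) :=
        hlines₀ ▸ ⟨j, rfl⟩
      refine ⟨D.line.symm ⟨_, hj⟩, hinj₀ (eq_of_pencilLine_le habcd (le_of_eq ?_))⟩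
      rw [hσ, Equiv.apply_symm_apply]
    obtain ⟨cls, Bl, hequiv, hassoc, hBl⟩ := hblocks (μ₀ ∘ σ) hinj hrange
    have hcomp0 : ∀ i, D.comp i ≠ 0 := fun i =>
      Finset.prod_ne_zero_iff.1 (D.associated_prod.ne_zero_iff.1 hf0) i (Finset.mem_univ i)
    have hprod : Associated (∏ i, D.comp i) (∏ i, (Bl i).det) :=
      D.associated_prod.symm.trans hassoc
    have hform : ∀ i, ∃ t : k, t ≠ 0 ∧ initialForm (D.comp i : MvPowerSeries (Fin 2) k) =
        MvPolynomial.C t * pencilForm a b c d ((μ₀ ∘ σ) i) ^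
          mult (D.comp i : MvPowerSeries (Fin 2) k) := by
      intro i
      -- The initial form of a component divides the product of those of the block determinants,
      -- which are powers of the pencil forms, and its zero set is a single line.
      refine exists_eq_C_mul_pencilForm_pow habcd (initialForm_isHomogeneous _)
        (Finset.mem_univ i) (m := fun i => mult ((Bl i).det : MvPowerSeries (Fin 2) k))
        (fun j _ hj => hinj hj) ?_ fun v hv => ?_
      · obtain ⟨-, t, ht, h1⟩ := exists_initialForm_eq_of_associated hprod
          (Finset.prod_ne_zero_iff.2 fun i _ => hcomp0 i)
        have e1 : ((∏ i, (Bl i).det : O) : MvPowerSeries (Fin 2) k) =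
          ∏ i, ((Bl i).det : MvPowerSeries (Fin 2) k) := map_prod O.val _ _
        have e2 : ((∏ i, D.comp i : O) : MvPowerSeries (Fin 2) k) =
          ∏ i, (D.comp i : MvPowerSeries (Fin 2) k) := map_prod O.val _ _
        rw [e1, e2, (prod_initialForm _ fun i _ => by simpa using (hBl i).2.1).2,
          (prod_initialForm _ fun i _ => by simpa using hcomp0 i).2] at h1
        have h2 : ∏ j, pencilForm a b c d ((μ₀ ∘ σ) j) ^
            mult ((Bl j).det : MvPowerSeries (Fin 2) k) =
            ∏ j, initialForm ((Bl j).det : MvPowerSeries (Fin 2) k) :=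
          Finset.prod_congr rfl fun j _ => by rw [(hBl j).2.2.2.1, MvPolynomial.C_1, one_mul]
        rw [h2, h1]
        exact (Finset.dvd_prod_of_mem _ (Finset.mem_univ i)).mul_right _
      · have h1 : v ∈ tangentCone (D.comp i : MvPowerSeries (Fin 2) k) := hv
        rw [D.tangentCone_comp i, ← hσ] at h1
        exact h1
    have hcomp : ∀ i, Associated (D.comp i) (Bl i).det :=
      hO.associated_of_associated_prod habcd hinj hprod hcomp0 (fun i => (hBl i).2.1) hform
        fun i => ⟨1, one_ne_zero, (hBl i).2.2.2.1⟩
    have hmult : ∀ i, mult (D.comp i : MvPowerSeries (Fin 2) k) =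
        mult ((Bl i).det : MvPowerSeries (Fin 2) k) := fun i =>
      (exists_initialForm_eq_of_associated (hcomp i) (hcomp0 i)).1
    -- Associated series have equal multiplicity, and that of a block determinant is the size of the
    -- block.
    let e : ∀ i, {j // cls j = i} ≃ Fin (mult (D.comp i : MvPowerSeries (Fin 2) k)) := fun i =>
      Fintype.equivFinOfCardEq (by rw [hmult, (hBl i).2.2.1])
    refine ⟨fun i => Matrix.reindex (e i) (e i) (Bl i), ?_, fun i => ?_⟩
    · rw [← reindex_sigmaCongrRight_blockDiagonal']
      exact hequiv.reindex_right _
    · have hdet : (Matrix.reindex (e i) (e i) (Bl i)).det = (Bl i).det :=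
        Matrix.det_reindex_self _ _
      have hzero : valueAtZero (Matrix.reindex (e i) (e i) (Bl i)) = 0 :=
        Matrix.ext fun x y => congrFun (congrFun (hBl i).1 ((e i).symm x)) ((e i).symm y)
      refine ⟨⟨hzero, ?_, ?_⟩, ?_⟩
      · rw [hdet]; exact (hBl i).2.1
      · rw [hdet]; exact (hcomp i).symm
      · rw [IsMaximallyGenerated, corankAtZero_eq_card hzero, hdet, Fintype.card_fin, hmult]

end Decomposition

end
end PlaneCurveGerm

theorem mainTheorem1 {k : Type*} [NormedField k] [CompleteSpace k] [IsAlgClosed k] [CharZero k]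
    (O : Subalgebra k (MvPowerSeries (Fin 2) k))
    (hO : O = ⊤ ∨ O = PlaneCurveGerm.convergentSeries k)
    (p : ℕ) (M : Matrix (Fin p) (Fin p) O) (f : O)
    (hM : PlaneCurveGerm.IsDetRep M f) (hmax : PlaneCurveGerm.IsMaximallyGenerated M) :
    Nonempty (PlaneCurveGerm.TangentialDecomposition f) ∧
    ∀ D : PlaneCurveGerm.TangentialDecomposition f,
      ∃ N : ∀ i : Fin D.r, Matrix
          (Fin (PlaneCurveGerm.mult (D.comp i : MvPowerSeries (Fin 2) k)))
          (Fin (PlaneCurveGerm.mult (D.comp i : MvPowerSeries (Fin 2) k))) O,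
        PlaneCurveGerm.LocallyEquivalent M (Matrix.blockDiagonal' N) ∧
        ∀ i, PlaneCurveGerm.IsDetRep (N i) (D.comp i) ∧
          PlaneCurveGerm.IsMaximallyGenerated (N i) := by
  have hadm : PlaneCurveGerm.IsAdmissible O := by
    rcases hO with rfl | rfl
    · exact PlaneCurveGerm.isAdmissible_top
    · exact PlaneCurveGerm.isAdmissible_convergentSeries
  exact hadm.tangential_decomposition hM hmax
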